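/- **Problem.** Let $\phi=f+r$ on $\mathbb R^d$, where $f:\mathbb R^d\to\mathbb R$ is $\rho$-weakly convex ($\rho>0$) and $r:\mathbb R^d\to(-\infty,+\infty]$ is convex, lower semicontinuous and bounded below. Let $x^0\in\operatorname{dom} r$ and $\phi(x^0)-\inf\phi\le\Delta$. Let $\bar\rho>0$, $\theta>0$, $R\ge0$, and for $\eta\in(0,\theta]$ let $f_\eta$ be a function bounded below, $\phi_\eta=f_\eta+r$, with error function $\mathcal R_\eta$ satisfying $\mathcal R_\eta(x)\le R\eta$ whenever $\phi_\eta(x)\le\phi_\eta(x^0)$. Put $\mathcal L_\eta(x,y)=B(x,y)+L(x,y)/\eta$. Assume one of the following. (A) For every $\eta\in(0,\theta]$: $f_\eta$ is $C^1$ and $\bar\rho$-weakly convex, $f_\eta\le f\le f_\eta+\mathcal R_\eta$ with $\mathcal R_\eta\ge 0$, and $\|\nabla f_\eta(x)-\nabla f_\eta(y)\|\le\mathcal L_\eta(x,y)\|x-y\|$ for all $x,y$. The functions $B,L:\mathbb R^d\times\mathbb R^d\to[0,\infty)$ are symmetric and continuous, and all sublevel sets of $\phi_\eta$ are bounded. (B)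 (Generalized Nesterov smoothing.) $f=h\circ A$ and $f_\eta=h_\eta\circ A$, where $V$ is an $m$-dimensional normed space, $h:V\to\mathbb R$ is convex with bounded $\operatorname{dom}h^*$, $A:\mathbb R^d\to V$ is $C^1$ with $L_A$-Lipschitz derivative (operator norm), and $h_\eta(z)=\sup_{y\in \operatorname{dom}h^*}\{\langle y,z\rangle-h^*(y)-\eta\,\omega(y)\}$ with $\omega$ nonnegative, bounded, lower semicontinuous and $\sigma$-strongly convex ($\sigma>0$, dual norm) on $\operatorname{dom}h^*$. Moreover $\mathcal R_\eta\equiv\eta\sup_{\operatorname{dom}h^*}\omega$, $B(x,y)\equiv L_A\sup_{y\in\operatorname{dom}h^*}\|y\|_{V^*}\le\bar\rho$ and $L(x,y)=\frac1\sigma\sup_{0\le t\le1}\|\nabla A(tx+(1-t)y)\|_{\rm op}^2$. For every $\eta\in(0,\theta]$ all sublevel sets of $h_\eta$ are bounded, and each coordinate $A_i$ ($i\in[m]$, with respect to a basis of $V$) is bounded below. **Algorithm (AGLS-SIPP).** Put $\hat\rho=2\bar\rho$, $\mu=\hat\rho-\bar\rho$. For $k=1,2,\dots$, $x^k$ is the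 output of AGLS started at $x^{k-1}$ and applied to $\min_x g(x)+\pi(x)$ with $g=f_\eta+\frac{\bar\rho}2\|\cdot-x^{k-1}\|^2$ and $\pi=r+\frac{\hat\rho-\bar\rho}2\|\cdot-x^{k-1}\|^2$. AGLS, with parameters $L_0>0$, $\tau_{\rm d}\in(0,1)$, $\tau_{\rm u}>1$ and start $\mathbf y^0=\mathbf z^0$, $\hat L_0=L_0$, takes at iteration $t\ge1$ the estimate $\hat L_t=\tau_{\rm d}\hat L_{t-1}\tau_{\rm u}^{j}$ with the smallest integer $j\ge0$ for which $$\mathbf x^t=(1-\alpha_t)\mathbf y^{t-1}+\alpha_t[(1-\beta_t)\mathbf y^{t-1}+\beta_t\mathbf z^{t-1}],\quad \mathbf z^t=\arg\min_{x}\{\langle\nabla g(\mathbf x^t),x\rangle+\pi(x)+\tfrac{\gamma_t}2\|x-\mathbf z^{t-1}\|^2\},\quad \mathbf y^t=(1-\alpha_t)\mathbf y^{t-1}+\alpha_t\mathbf z^t$$ satisfy $g(\mathbf y^t)\le g(\mathbf x^t)+\langle\nabla g(\mathbf x^t),\mathbf y^t-\mathbf x^t\rangle+\frac{\hat L_t}2\|\mathbf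 y^t-\mathbf x^t\|^2$. Here $\gamma_t=(\hat L_t+\mu)\alpha_t-\mu$, $\beta_t=\gamma_t/(\hat L_t\alpha_t)$, $\alpha_1=\sqrt{\mu/(\hat L_1+\mu)}$, and for $t\ge2$ $\alpha_t$ is the positive root of $(\hat L_t+\mu)\alpha^2+(b_{t-1}-\mu)\alpha-b_{t-1}=0$ with $b_{t-1}=\alpha_{t-1}^2(\hat L_{t-1}+\mu)$. It stops at the first $t\ge1$ with $\prod_{i=1}^t\bigl(1-\sqrt{\mu/(\hat L_i+\mu)}\bigr)\le\frac14$ and returns $\mathbf y^t$. A point $x$ is $(\delta,\epsilon)$-stationary for $\phi$ if there is $\hat x\in\operatorname{dom}\phi$ with $\|\hat x-x\|\le\delta$ and $\operatorname{dist}(0,\partial\phi(\hat x))\le\epsilon$, where $\partial$ is the limiting subdifferential. **Claim.** There are a constant $c$ depending only on $\rho,\bar\rho,R$, a constant $C$ depending only on $\rho,\bar\rho,R,\theta,\Delta,\tau_{\rm u},L_0$, and a constant $C'$ depending on the problem and on the parameters but not on $\varepsilon$, such that for every $\varepsilon>0$ with $\varepsilon^2\le\theta$, AGLS-SIPP with $\eta=\varepsilon^2$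 is well defined (every line search and every inner loop terminates) and after some number $K\ge1$ of outer iterations $x^K$ is a $(c\varepsilon,c\varepsilon)$-stationary point of $\phi$, the total number $N$ of AGLS iterations up to then satisfying, for every lower bound $l$ of $\phi_\eta$, $$N\le \frac{C}{\varepsilon^2}\Bigl(\sqrt{B^\dagger}+\frac{\sqrt{L^\dagger}}{\varepsilon}+1\Bigr)\qquad\text{and}\qquad N\le\frac{C'}{\varepsilon^3}.$$ Here $S_0=\{x:\phi_\eta(x)\le\phi_\eta(x^0)\}$, $D^\dagger=\sqrt{\frac8{\hat\rho-\bar\rho}[\phi(x^0)-l]}$, and $B^\dagger=\sup B(x,y)$, $L^\dagger=\sup L(x,y)$, $\mathcal L^\dagger=\sup\{2\mathcal L_\eta(x,y)+2\bar\rho\}$ over all pairs $x,y$ lying in a common closed ball of radius $D^\dagger$ centered at a point of $S_0$; these three suprema are finite. If the sublevel sets of $\phi_\eta$ are bounded (in particular in case (A)), the same holds, with the same $K$ and $N$, when the suprema are taken over all pairs $x,y$ with $\operatorname{dist}(x,S_0)\le D^\dagger$ and $\operatorname{dist}(y,S_0)\le D^\dagger$. No global Lipschitz bound on $\nabla f_\eta$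 is assumed. -/

import Mathlib

open Set Filter Topology

noncomputable section

/-- The Euclidean space `ℝ^d`. -/
abbrev Eucl (d : ℕ) : Type := EuclideanSpace ℝ (Fin d)

/-! ### Functions, subdifferentials, stationarity -/

/-- `f` is `ρ`-weakly convex: `f + (ρ/2)‖·‖²` is convex. -/
def IsWeaklyConvex {d : ℕ} (ρ : ℝ) (f : Eucl d → ℝ) : Prop :=
  ConvexOn ℝ univ (fun x => f x + ρ / 2 * ‖x‖ ^ 2)

/-- Convexity of an extended-real-valued function, through its epigraph. -/
def IsConvexExt {d : ℕ} (r : Eucl d → EReal) : Prop :=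
  Convex ℝ {p : Eucl d × ℝ | r p.1 ≤ (p.2 : EReal)}

/-- The composite objective `f + r`. -/
def composite {d : ℕ} (f : Eucl d → ℝ) (r : Eucl d → EReal) (x : Eucl d) : EReal :=
  (f x : EReal) + r x

/-- All sublevel sets are bounded. -/
def LevelBounded {d : ℕ} (φ : Eucl d → EReal) : Prop :=
  ∀ v : ℝ, Bornology.IsBounded {x | φ x ≤ (v : EReal)}

/-- The Fréchet subdifferential of an extended-real-valued function (empty where the function
is not finite): `φ y ≥ φ x + ⟨v, y - x⟩ + o(‖y - x‖)` as `y → x`. -/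
def frechetSubdiff {d : ℕ} (φ : Eucl d → EReal) (x : Eucl d) : Set (Eucl d) :=
  {v | φ x ≠ ⊤ ∧ φ x ≠ ⊥ ∧ ∀ c > (0 : ℝ), ∀ᶠ y in 𝓝 x,
    (((φ x).toReal + inner ℝ v (y - x) - c * ‖y - x‖ : ℝ) : EReal) ≤ φ y}

/-- The limiting subdifferential. -/
def limitingSubdiff {d : ℕ} (φ : Eucl d → EReal) (x : Eucl d) : Set (Eucl d) :=
  {v | φ x ≠ ⊤ ∧ φ x ≠ ⊥ ∧ ∃ (xs vs : ℕ → Eucl d),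
    Tendsto xs atTop (𝓝 x) ∧ Tendsto (fun n => φ (xs n)) atTop (𝓝 (φ x)) ∧
    (∀ n, vs n ∈ frechetSubdiff φ (xs n)) ∧ Tendsto vs atTop (𝓝 v)}

/-- `x` is a `(δ, ε)`-stationary point of `φ`: some `x̂ ∈ dom φ` has `‖x̂ - x‖ ≤ δ` and
`dist (0, ∂φ(x̂)) ≤ ε` (the distance to the empty set being `+∞`). -/
def IsApproxStationary {d : ℕ} (φ : Eucl d → EReal) (δ ε : ℝ) (x : Eucl d) : Prop :=
  ∃ xhat : Eucl d, φ xhat ≠ ⊤ ∧ ‖xhat - x‖ ≤ δ ∧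
    Metric.infEDist 0 (limitingSubdiff φ xhat) ≤ ENNReal.ofReal ε

/-! ### Smooth approximations -/

/-- `fs` is a `(ρbar, Rs, Ls)`-smooth approximation of `f` on `ℝ^d`. -/
structure IsSmoothApprox {d : ℕ} (f fs : Eucl d → ℝ) (ρbar : ℝ) (Rs : Eucl d → ℝ)
    (Ls : Eucl d → Eucl d → ℝ) : Prop where
  contDiff : ContDiff ℝ 1 fs
  weaklyConvex : IsWeaklyConvex ρbar fs
  error_nonneg : ∀ x, 0 ≤ Rs x
  modulus_nonneg : ∀ x y, 0 ≤ Ls x y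
  modulus_symm : ∀ x y, Ls x y = Ls y x
  lower : ∀ x, fs x ≤ f x
  upper : ∀ x, f x ≤ fs x + Rs x
  smooth : ∀ x y, ‖gradient fs x - gradient fs y‖ ≤ Ls x y * ‖x - y‖

/-! ### Generalized Nesterov smoothing -/

/-- Domain of the convex conjugate `h*` of a real-valued function `h`. -/
def conjDomain {V : Type} [NormedAddCommGroup V] [NormedSpace ℝ V] (h : V → ℝ) :
    Set (StrongDual ℝ V) :=
  {y | BddAbove (range fun z => y z - h z)}

/-- The convex conjugate `h*(y) = sup_z (⟨y, z⟩ - h z)`, a real number for `y ∈ conjDomain h`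
and used only there. -/
def conjValue {V : Type} [NormedAddCommGroup V] [NormedSpace ℝ V] (h : V → ℝ)
    (y : StrongDual ℝ V) : ℝ :=
  ⨆ z, (y z - h z)

/-- Data of generalized Nesterov smoothing of `h ∘ A` with `A : ℝ^d → V`, where `V` is a
finite-dimensional space with an arbitrary norm, coordinates given by `basis`, and dual
`StrongDual ℝ V` with the dual norm. The prox-function `ω` matters only on `dom h*`. -/
structure NesterovSmoothing (d : ℕ) where
  m : ℕ
  V : Type
  [normed : NormedAddCommGroup V]
  [space : NormedSpace ℝ V]
  basis : Module.Basis (Fin m) ℝ V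
  h : V → ℝ
  A : Eucl d → V
  ω : StrongDual ℝ V → ℝ
  σ : ℝ
  LA : ℝ
  h_convex : ConvexOn ℝ univ h
  dom_bounded : Bornology.IsBounded (conjDomain h)
  A_contDiff : ContDiff ℝ 1 A
  LA_nonneg : 0 ≤ LA
  A_smooth : ∀ x x', ‖fderiv ℝ A x - fderiv ℝ A x'‖ ≤ LA * ‖x - x'‖
  σ_pos : 0 < σ
  ω_lsc : LowerSemicontinuousOn ω (conjDomain h)
  ω_strongConvex : StrongConvexOn (conjDomain h) σ ω
  ω_nonneg : ∀ y ∈ conjDomain h, 0 ≤ ω y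
  ω_bounded : BddAbove (ω '' conjDomain h)

attribute [instance] NesterovSmoothing.normed NesterovSmoothing.space

namespace NesterovSmoothing

variable {d : ℕ} (N : NesterovSmoothing d)

/-- `h_η(z) = sup_y (⟨y, z⟩ - h*(y) - η ω(y))`, the supremum being over `dom h*`. -/
def hη (η : ℝ) (z : N.V) : ℝ :=
  ⨆ y : conjDomain N.h, ((y : StrongDual ℝ N.V) z - conjValue N.h y - η * N.ω y)

/-- `sup {‖y‖ : y ∈ dom h*}`. -/
def dualRadius : ℝ := sSup ((fun y => ‖y‖) '' conjDomain N.h)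

/-- `sup {ω(y) : y ∈ dom h*}`. -/
def proxDiam : ℝ := sSup (N.ω '' conjDomain N.h)

/-- `(1/σ) sup_{0 ≤ t ≤ 1} ‖∇A(t x + (1 - t) y)‖²`, with the operator norm. -/
def jacModulus (x y : Eucl d) : ℝ :=
  N.σ⁻¹ * ⨆ t : Icc (0 : ℝ) 1, ‖fderiv ℝ N.A ((t : ℝ) • x + (1 - (t : ℝ)) • y)‖ ^ 2

end NesterovSmoothing

/-! ### The accelerated gradient method with line search (AGLS) -/

/-- Quantities `x^t, y^t, z^t, L̂_t, α_t, β_t, γ_t` of one AGLS iteration. -/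
structure AGLSState (d : ℕ) where
  x : Eucl d
  y : Eucl d
  z : Eucl d
  Lhat : ℝ
  α : ℝ
  β : ℝ
  γ : ℝ

/-- Initial state; the weights at `t = 0` are never used. -/
def AGLSState.init {d : ℕ} (x0 : Eucl d) (L0 : ℝ) : AGLSState d := ⟨x0, x0, x0, L0, 0, 0, 0⟩

/-- `s'` is the line-search trial of iteration `t` computed from the state `s` with the
estimate `s'.Lhat`, for minimizing `g + π` with `π` `μ`-strongly convex. The first weight is
`α₁ = √(μ/(L̂₁+μ))`; for `t ≥ 2`, `α_t` is the positive root of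
`(L̂_t+μ)α² + (b-μ)α - b = 0` with `b = α_{t-1}²(L̂_{t-1}+μ)`. -/
structure AGLSTrial {d : ℕ} (g : Eucl d → ℝ) (π : Eucl d → EReal) (μ : ℝ) (t : ℕ)
    (s s' : AGLSState d) : Prop where
  weight_first : t = 1 → s'.α = √(μ / (s'.Lhat + μ))
  weight_later : t ≠ 1 → 0 < s'.α ∧
    (s'.Lhat + μ) * s'.α ^ 2 + (s.α ^ 2 * (s.Lhat + μ) - μ) * s'.α
      - s.α ^ 2 * (s.Lhat + μ) = 0
  gamma_eq : s'.γ = (s'.Lhat + μ) * s'.α - μ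
  beta_eq : s'.β = s'.γ / (s'.Lhat * s'.α)
  x_eq : s'.x = (1 - s'.α) • s.y + s'.α • ((1 - s'.β) • s.y + s'.β • s.z)
  z_argmin : ∀ w : Eucl d,
    ((inner ℝ (gradient g s'.x) s'.z + s'.γ / 2 * ‖s'.z - s.z‖ ^ 2 : ℝ) : EReal) + π s'.z
      ≤ ((inner ℝ (gradient g s'.x) w + s'.γ / 2 * ‖w - s.z‖ ^ 2 : ℝ) : EReal) + π w
  y_eq : s'.y = (1 - s'.α) • s.y + s'.α • s'.z

/-- The trial with estimate `Lhat` is computed and passes the descent test. -/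
def AGLSAccepts {d : ℕ} (g : Eucl d → ℝ) (π : Eucl d → EReal) (μ : ℝ) (t : ℕ)
    (s : AGLSState d) (Lhat : ℝ) (s' : AGLSState d) : Prop :=
  s'.Lhat = Lhat ∧ AGLSTrial g π μ t s s' ∧
    g s'.y ≤ g s'.x + inner ℝ (gradient g s'.x) (s'.y - s'.x) + Lhat / 2 * ‖s'.y - s'.x‖ ^ 2

/-- One AGLS iteration: `L̂_t = τd L̂_{t-1} τu^k` with the smallest `k ≥ 0` that is accepted. -/
def AGLSStep {d : ℕ} (g : Eucl d → ℝ) (π : Eucl d → EReal) (μ τd τu : ℝ) (t : ℕ)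
    (s s' : AGLSState d) : Prop :=
  ∃ k : ℕ, IsLeast {j : ℕ | ∃ s'', AGLSAccepts g π μ t s (τd * s.Lhat * τu ^ j) s''} k ∧
    AGLSAccepts g π μ t s (τd * s.Lhat * τu ^ k) s'

/-- `s 0, …, s T` is the run of AGLS with early stop from `x0`: it stops at the first `T ≥ 1`
with `∏_{i ≤ T} (1 - √(μ/(L̂_i+μ))) ≤ 1/4`, after `T` iterations (states after `T` are
irrelevant). -/
def IsAGLSRun {d : ℕ} (g : Eucl d → ℝ) (π : Eucl d → EReal) (μ L0 τd τu : ℝ) (x0 : Eucl d)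
    (s : ℕ → AGLSState d) (T : ℕ) : Prop :=
  s 0 = AGLSState.init x0 L0 ∧
  (∀ t, 1 ≤ t → t ≤ T → AGLSStep g π μ τd τu t (s (t - 1)) (s t)) ∧
  IsLeast {t : ℕ | 1 ≤ t ∧ ∏ i ∈ Finset.Icc 1 t, (1 - √(μ / ((s i).Lhat + μ))) ≤ 1 / 4} T

/-! ### The inexact proximal point method with AGLS as inner solver (AGLS-SIPP) -/

/-- A run of AGLS-SIPP on `fs + r` from `x0` with proximal parameter `ρhat > ρbar`: `xs (k+1)`
is the output of AGLS with early stop, started at `xs k`, on the subproblem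
`min_w fs(w) + r(w) + (ρhat/2)‖w - xs k‖²`, split into the convex smooth part
`fs + (ρbar/2)‖· - xs k‖²` and the `(ρhat - ρbar)`-strongly convex part
`r + ((ρhat - ρbar)/2)‖· - xs k‖²`; `T (k+1)` is the number of AGLS iterations spent on it. -/
structure IsAGLSSIPPRun {d : ℕ} (fs : Eucl d → ℝ) (r : Eucl d → EReal)
    (ρbar ρhat L0 τd τu : ℝ) (x0 : Eucl d) (xs : ℕ → Eucl d) (T : ℕ → ℕ) : Prop where
  start : xs 0 = x0
  next : ∀ k, ∃ s : ℕ → AGLSState d,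
    IsAGLSRun (fun w => fs w + ρbar / 2 * ‖w - xs k‖ ^ 2)
      (fun w => r w + (((ρhat - ρbar) / 2 * ‖w - xs k‖ ^ 2 : ℝ) : EReal))
      (ρhat - ρbar) L0 τd τu (xs k) s (T (k + 1)) ∧
    xs (k + 1) = (s (T (k + 1))).y

/-! ### The region that contains the iterates -/

/-- The initial sublevel set `S₀ = {x : φ x ≤ φ x0}`. -/
def initialLevel {d : ℕ} (φ : Eucl d → EReal) (x0 : Eucl d) : Set (Eucl d) := {x | φ x ≤ φ x0}

/-- Pairs of points that lie in one closed ball of radius `D` centered in `S`. -/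
def commonBallPairs {d : ℕ} (S : Set (Eucl d)) (D : ℝ) : Set (Eucl d × Eucl d) :=
  {p | ∃ s ∈ S, p.1 ∈ Metric.closedBall s D ∧ p.2 ∈ Metric.closedBall s D}

/-- Pairs of points at distance at most `D` from `S`. -/
def tubePairs {d : ℕ} (S : Set (Eucl d)) (D : ℝ) : Set (Eucl d × Eucl d) :=
  {p | Metric.infDist p.1 S ≤ D ∧ Metric.infDist p.2 S ≤ D}

/-- `sup {F(x, y) : (x, y) ∈ P}`. -/
def pairSup {d : ℕ} (F : Eucl d → Eucl d → ℝ) (P : Set (Eucl d × Eucl d)) : ℝ :=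
  sSup ((fun p => F p.1 p.2) '' P)

/-- `F` is bounded above on the pairs in `P`. -/
def PairBounded {d : ℕ} (F : Eucl d → Eucl d → ℝ) (P : Set (Eucl d × Eucl d)) : Prop :=
  BddAbove ((fun p => F p.1 p.2) '' P)

end

/-! ### Convexity and first-order conditions -/

/-! The gradient of `f_η` has no global Lipschitz constant, so the proof rests on confining the
iterates.

Inner loop. The first weight makes `b_t = μ` for every `t`, so `α_t = √(μ/(L̂_t+μ))` throughout
(`AGLSTrial.alpha_eq`), and an accepted step multiplies the energy `ψ(y) - ψ(w) + (μ/2)‖w - z‖²` by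
at most `1 - α_t` (`AGLSModel.energy_le`). Take for `w` the minimizer `xm` of the subproblem. The
initial energy is at most twice the initial gap, so `y` and `z` stay within `3D/4` of `xm`. Let `M`
be a Lipschitz constant of `∇g` on the ball of radius `D` around `xm`. A trial with estimate at
least `3M` cannot leave this ball (`AGLSModel.trial_mem_closedBall`), so it passes the descent test.
Hence `L̂_t ≤ Λ = max(L0, 3Mτu)`, the stopping product decays geometrically, AGLS stops after
`O(√((Λ+μ)/μ))` iterations, and quartering the energy halves the gap of the subproblem
(`AGLSModel.run_bound`).

Outer loop. Halving the gap lowers `φ_η` by at least half the gap. So the iterates and the proximal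
points, which are the centers of the balls, stay in `S₀`, and among the first `O(ε⁻²)` steps one has
gap at most `ε²` (`exists_small_gap`). A proximal step for `φ` itself from the proximal point of
that step gives the nearby point with a small subgradient: function errors of order `η = ε²` move
points by `O(ε)` (`SmoothedProblem.isApproxStationary`).

Moduli. `B` and `L` must be bounded near `S₀` uniformly in `η`. In case (A) all the sets `S₀` lie in
one bounded sublevel set of `φ_θ`, and continuity suffices. In case (B) `S₀` may be unbounded, but
`A` maps it into a bounded set. A function bounded below with Lipschitz derivative has its
derivative controlled by its value, so `∇A` is bounded on `S₀`, and by its Lipschitz continuity on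
balls centered there. The segment between two points of one ball stays in the ball; this is why
pairs in a common ball are used. -/

lemma le_deriv_of_forall_mul_le {h : ℝ → ℝ} {h' c : ℝ} (hh : HasDerivAt h h' 0)
    (hc : ∀ t ∈ Ioo (0 : ℝ) 1, h 0 + t * c ≤ h t) : c ≤ h' := by
  have hs := (hasDerivAt_iff_tendsto_slope.1 hh).mono_left
    (nhdsWithin_mono (0 : ℝ) (fun t (ht : t ∈ Ioi (0 : ℝ)) => (ne_of_gt ht : t ≠ 0)))
  refine ge_of_tendsto hs ?_
  filter_upwards [Ioo_mem_nhdsGT (zero_lt_one' ℝ)] with t ht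
  rw [slope_def_field, sub_zero, le_div_iff₀ ht.1]
  linarith [hc t ht]

section Normed

variable {E : Type*} [NormedAddCommGroup E] [NormedSpace ℝ E]

lemma HasFDerivAt.hasDerivAt_lineSegment {g : E → ℝ} {g' : E →L[ℝ] ℝ} {x v : E} {t : ℝ}
    (hg : HasFDerivAt g g' (x + t • v)) : HasDerivAt (fun s : ℝ => g (x + s • v)) (g' v) t := by
  have h1 : HasDerivAt (fun s : ℝ => x + s • v) v t := by
    simpa using ((hasDerivAt_id t).smul_const v).const_add x
  exact hg.comp_hasDerivAt t h1

/-- First-order optimality for the sum of a differentiable and a strongly convex function. -/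
lemma StrongConvexOn.le_of_isMin_add {C : Set E} {m : ℝ} {p g : E → ℝ} {g' : E →L[ℝ] ℝ} {z w : E}
    (hp : StrongConvexOn C m p) (hz : z ∈ C) (hw : w ∈ C) (hg : HasFDerivAt g g' z)
    (hmin : ∀ u ∈ C, g z + p z ≤ g u + p u) :
    p z - g' (w - z) + m / 2 * ‖w - z‖ ^ 2 ≤ p w := by
  -- Comparing `z` with `z + t(w - z)` leaves an error `t² (m/2)‖w - z‖²`. It is absorbed into the
  -- function of `t`, since its derivative vanishes at `0`.
  have hd : HasDerivAt (fun t : ℝ => g (z + t • (w - z)) + t ^ 2 * (m / 2 * ‖w - z‖ ^ 2))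
      (g' (w - z)) 0 := by
    have h1 : HasDerivAt (fun t : ℝ => g (z + t • (w - z))) (g' (w - z)) 0 :=
      HasFDerivAt.hasDerivAt_lineSegment (by simpa using hg)
    have h2 := ((hasDerivAt_id (0 : ℝ)).pow 2).mul_const (m / 2 * ‖w - z‖ ^ 2)
    simpa using! h1.add h2
  have := le_deriv_of_forall_mul_le (c := m / 2 * ‖w - z‖ ^ 2 - (p w - p z)) hd (fun t ht => by
    have ht0 : 0 ≤ t := ht.1.le
    have ht1 : 0 ≤ 1 - t := by linarith [ht.2]
    have hmem := hp.1 hz hw ht1 ht0 (by ring)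
    have h1 := hp.2 hz hw ht1 ht0 (by ring)
    have h2 := hmin _ hmem
    have e : (1 - t) • z + t • w = z + t • (w - z) := by module
    rw [e] at h1 h2
    rw [norm_sub_rev] at h1
    simp only [smul_eq_mul] at h1
    simp only [zero_smul, add_zero]
    linarith)
  linarith

lemma StrongConvexOn.add_sq_le_of_isMin {C : Set E} {m : ℝ} {F : E → ℝ} {z w : E}
    (hF : StrongConvexOn C m F) (hz : z ∈ C) (hw : w ∈ C) (hmin : ∀ u ∈ C, F z ≤ F u) :
    F z + m / 2 * ‖w - z‖ ^ 2 ≤ F w := by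
  have := hF.le_of_isMin_add hz hw (hasFDerivAt_const (0 : ℝ) z) (by simpa using hmin)
  simpa using this

lemma ConvexOn.add_fderiv_le {g : E → ℝ} {g' : E →L[ℝ] ℝ} {x : E} (hg : ConvexOn ℝ univ g)
    (hx : HasFDerivAt g g' x) (y : E) : g x + g' (y - x) ≤ g y := by
  have hd : HasDerivAt (fun t : ℝ => - g (x + t • (y - x))) (- g' (y - x)) 0 :=
    (HasFDerivAt.hasDerivAt_lineSegment (by simpa using hx)).neg
  have := le_deriv_of_forall_mul_le (c := g x - g y) hd (fun t ht => by
    have h1 := hg.2 (mem_univ x) (mem_univ y) (by linarith [ht.2] : 0 ≤ 1 - t) ht.1.le (by ring)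
    have e : (1 - t) • x + t • y = x + t • (y - x) := by module
    rw [e] at h1
    simp only [smul_eq_mul] at h1
    simp only [zero_smul, add_zero]
    linarith)
  linarith

/-- The descent lemma along a segment. -/
lemma le_add_fderiv_add_sq {g : E → ℝ} {g' : E → E →L[ℝ] ℝ} {M : ℝ} {x y : E}
    (hg : ∀ u, HasFDerivAt g (g' u) u)
    (hM : ∀ t ∈ Icc (0 : ℝ) 1, ‖g' (x + t • (y - x)) - g' x‖ ≤ M * (t * ‖y - x‖)) :
    g y ≤ g x + g' x (y - x) + M / 2 * ‖y - x‖ ^ 2 := by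
  have hd : ∀ t : ℝ, HasDerivAt (fun t : ℝ => g (x + t • (y - x)))
      (g' (x + t • (y - x)) (y - x)) t := fun t => (hg _).hasDerivAt_lineSegment
  have hB : ∀ t : ℝ, HasDerivAt
      (fun t : ℝ => g x + t * g' x (y - x) + M / 2 * ‖y - x‖ ^ 2 * t ^ 2)
      (g' x (y - x) + M * ‖y - x‖ ^ 2 * t) t := fun t => by
    have := (((hasDerivAt_id t).mul_const (g' x (y - x))).const_add (g x)).add
      (((hasDerivAt_id t).pow 2).const_mul (M / 2 * ‖y - x‖ ^ 2))
    convert! this using 1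
    simp
    ring
  have := image_le_of_deriv_right_le_deriv_boundary (a := 0) (b := 1)
    (fun t _ => (hd t).continuousAt.continuousWithinAt) (fun t _ => (hd t).hasDerivWithinAt)
    (by simp) (fun t _ => (hB t).continuousAt.continuousWithinAt)
    (fun t _ => (hB t).hasDerivWithinAt) (fun t ht => by
      have h1 := (le_abs_self _).trans
        ((g' (x + t • (y - x)) - g' x).le_of_opNorm_le (hM t ⟨ht.1, ht.2.le⟩) (y - x))
      rw [sub_apply] at h1
      nlinarith) (right_mem_Icc.2 zero_le_one)
  simpa using this

end Normed

section Inner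

variable {E : Type*} [NormedAddCommGroup E] [InnerProductSpace ℝ E]

lemma norm_sq_convex_comb_sub (z w p : E) {a b : ℝ} (hab : a + b = 1) :
    ‖a • z + b • w - p‖ ^ 2 = a * ‖z - p‖ ^ 2 + b * ‖w - p‖ ^ 2 - a * b * ‖z - w‖ ^ 2 := by
  have e1 : a • z + b • w - p = a • (z - p) + b • (w - p) := by
    have : p = (a + b) • p := by rw [hab, one_smul]
    rw [smul_sub, smul_sub]
    nth_rw 1 [this]
    module
  have e2 : z - w = (z - p) - (w - p) := by abel
  rw [e1, e2]
  generalize z - p = u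
  generalize w - p = v
  rw [norm_add_sq_real, norm_sub_sq_real, norm_smul, norm_smul, inner_smul_left,
    inner_smul_right, mul_pow, mul_pow, Real.norm_eq_abs, Real.norm_eq_abs, sq_abs, sq_abs]
  obtain rfl : b = 1 - a := by linarith
  simp
  ring

lemma StrongConvexOn.add_sq {C : Set E} {a m : ℝ} {F : E → ℝ} (hF : StrongConvexOn C a F) (p : E) :
    StrongConvexOn C (a + m) (fun x => F x + m / 2 * ‖x - p‖ ^ 2) := by
  refine ⟨hF.1, fun x hx y hy s t hs ht hst => ?_⟩
  have h := hF.2 hx hy hs ht hst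
  have e := norm_sq_convex_comb_sub x y p hst
  simp only [smul_eq_mul] at h ⊢
  rw [e]
  linarith

lemma ConvexOn.strongConvexOn_add_sq {C : Set E} {m : ℝ} {F : E → ℝ} (hF : ConvexOn ℝ C F) (p : E) :
    StrongConvexOn C m (fun x => F x + m / 2 * ‖x - p‖ ^ 2) := by
  simpa using (strongConvexOn_zero.2 hF).add_sq (m := m) p

lemma StrongConvexOn.add_inner {C : Set E} {m : ℝ} {F : E → ℝ} (hF : StrongConvexOn C m F) (v : E) :
    StrongConvexOn C m (fun x => inner ℝ v x + F x) := by
  refine ⟨hF.1, fun x hx y hy s t hs ht hst => ?_⟩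
  have h := hF.2 hx hy hs ht hst
  simp only [smul_eq_mul, inner_add_right, inner_smul_right] at h ⊢
  linarith

/-- Weak convexity does not depend on the center of the quadratic. -/
lemma ConvexOn.add_sq_sub {ρ : ℝ} {f : E → ℝ} {C : Set E}
    (hf : ConvexOn ℝ C (fun x => f x + ρ / 2 * ‖x‖ ^ 2)) (p : E) :
    ConvexOn ℝ C (fun x => f x + ρ / 2 * ‖x - p‖ ^ 2) := by
  refine ⟨hf.1, fun x hx y hy s t hs ht hst => ?_⟩
  have h := hf.2 hx hy hs ht hst
  have e := norm_sq_convex_comb_sub x y p hst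
  have e0 := norm_sq_convex_comb_sub x y 0 hst
  simp only [sub_zero] at e0
  simp only [smul_eq_mul] at h ⊢
  rw [e]
  rw [e0] at h
  linarith

end Inner

/-! ### Extended-real-valued convex functions -/

section ExtendedReal

variable {d : ℕ} {r : Eucl d → EReal}

lemma ne_bot_of_coe_le {r : Eucl d → EReal} {a : ℝ} (ha : ∀ x, (a : EReal) ≤ r x) (x : Eucl d) :
    r x ≠ ⊥ :=
  ne_bot_of_le_ne_bot (EReal.coe_ne_bot a) (ha x)

lemma IsConvexExt.convexOn_toReal (hr : IsConvexExt r) (hbot : ∀ x, r x ≠ ⊥) :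
    ConvexOn ℝ {x | r x ≠ ⊤} (fun x => (r x).toReal) := by
  have key : ∀ x, r x ≠ ⊤ → ∀ y, r y ≠ ⊤ → ∀ s t : ℝ, 0 ≤ s → 0 ≤ t → s + t = 1 →
      r (s • x + t • y) ≤ ((s * (r x).toReal + t * (r y).toReal : ℝ) : EReal) := by
    intro x hx y hy s t hs ht hst
    have := hr (x := (x, (r x).toReal)) (EReal.coe_toReal hx (hbot x)).ge
      (y := (y, (r y).toReal)) (EReal.coe_toReal hy (hbot y)).ge hs ht hst
    simpa using! this
  have hne : ∀ x, r x ≠ ⊤ → ∀ y, r y ≠ ⊤ → ∀ s t : ℝ, 0 ≤ s → 0 ≤ t → s + t = 1 →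
      r (s • x + t • y) ≠ ⊤ := fun x hx y hy s t hs ht hst =>
    ne_top_of_le_ne_top (EReal.coe_ne_top _) (key x hx y hy s t hs ht hst)
  refine ⟨fun x hx y hy s t hs ht hst => hne x hx y hy s t hs ht hst,
    fun x hx y hy s t hs ht hst => ?_⟩
  have h := key x hx y hy s t hs ht hst
  rw [← EReal.coe_toReal (hne x hx y hy s t hs ht hst) (hbot _), EReal.coe_le_coe_iff] at h
  simpa using h

lemma add_sq_ne_top_iff {a : EReal} {b : ℝ} : (b : EReal) + a ≠ ⊤ ↔ a ≠ ⊤ := by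
  induction a with
  | bot => simp
  | coe a => exact iff_of_true (by rw [← EReal.coe_add]; exact EReal.coe_ne_top _) (EReal.coe_ne_top _)
  | top => simp

/-- A coercive continuous function plus a lower semicontinuous one attains its minimum. -/
lemma exists_argmin_coe_add {q : Eucl d → ℝ} (hq : Continuous q) (hr : LowerSemicontinuous r)
    {a : ℝ} (ha : ∀ x, (a : EReal) ≤ r x) {x0 : Eucl d} (hx0 : r x0 ≠ ⊤) {c b : ℝ} {p : Eucl d}
    (hc : 0 < c) (hcoer : ∀ x, c * ‖x - p‖ ^ 2 + b ≤ q x) :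
    ∃ z, r z ≠ ⊤ ∧ ∀ w, (q z : EReal) + r z ≤ (q w : EReal) + r w := by
  set v : ℝ := q x0 + (r x0).toReal with hv
  have hx0v : (q x0 : EReal) + r x0 = (v : EReal) := by
    rw [hv, EReal.coe_add, EReal.coe_toReal hx0 (ne_bot_of_coe_le ha x0)]
  -- Off `K`, `q + a` already exceeds the value at `x0`, so a minimizer over the compact set `K` is
  -- global.
  set K : Set (Eucl d) := {x | q x ≤ v - a} with hK
  have hax0 : a ≤ (r x0).toReal := by
    have := ha x0
    rwa [← EReal.coe_toReal hx0 (ne_bot_of_coe_le ha x0), EReal.coe_le_coe_iff] at this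
  have hKc : IsCompact K := by
    refine Metric.isCompact_of_isClosed_isBounded (isClosed_le hq continuous_const) ?_
    refine (Metric.isBounded_closedBall (x := p) (r := 1 + (v - a - b) / c)).subset ?_
    intro x hx
    have h1 := hcoer x
    have h2 : q x ≤ v - a := hx
    rw [mem_closedBall_iff_norm]
    have h3 : ‖x - p‖ ^ 2 ≤ (v - a - b) / c := by
      rw [le_div_iff₀ hc]; linarith
    nlinarith [sq_nonneg (‖x - p‖ - 1)]
  have hx0K : x0 ∈ K := by simp only [hK, mem_ofPred_eq, hv]; linarith
  have hlsc : LowerSemicontinuous (fun x => (q x : EReal) + r x) := by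
    refine LowerSemicontinuous.add' ?_ hr fun x => ?_
    · exact (continuous_coe_real_ereal.comp hq).lowerSemicontinuous
    · exact EReal.continuousAt_add (.inl (EReal.coe_ne_top _)) (.inl (EReal.coe_ne_bot _))
  obtain ⟨z, hzK, hz⟩ := LowerSemicontinuousOn.exists_isMinOn ⟨x0, hx0K⟩ hKc
    (hlsc.lowerSemicontinuousOn K)
  rw [isMinOn_iff] at hz
  have hzv : (q z : EReal) + r z ≤ (v : EReal) := (hz x0 hx0K).trans hx0v.le
  refine ⟨z, fun h => ?_, fun w => ?_⟩
  · rw [h, EReal.coe_add_top] at hzv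
    exact EReal.coe_ne_top v (top_le_iff.1 hzv)
  · by_cases hw : w ∈ K
    · exact hz w hw
    · have h1 : v ≤ q w + a := by
        simp only [hK, mem_ofPred_eq, not_le] at hw; linarith
      refine hzv.trans ((EReal.coe_le_coe_iff.2 h1).trans ?_)
      rw [EReal.coe_add]
      exact add_le_add le_rfl (ha w)

end ExtendedReal

/-! ### One iteration of AGLS -/

/-- Standing assumptions for AGLS on `g + π`: `g` is smooth and convex, `π` is `μ`-strongly convex
with computable proximal steps, `xm` minimizes `g + π`, and `∇g` is `M`-Lipschitz on the closed
ball of radius `D` around `xm`. -/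
structure AGLSModel {d : ℕ} (g : Eucl d → ℝ) (π : Eucl d → EReal) (μ : ℝ) (xm : Eucl d)
    (D M : ℝ) : Prop where
  mu_pos : 0 < μ
  ne_bot : ∀ x, π x ≠ ⊥
  strongConvex : StrongConvexOn {x | π x ≠ ⊤} μ (fun x => (π x).toReal)
  exists_argmin : ∀ (v z : Eucl d) (γ : ℝ), 0 ≤ γ → ∃ u, ∀ w,
    ((inner ℝ v u + γ / 2 * ‖u - z‖ ^ 2 : ℝ) : EReal) + π u
      ≤ ((inner ℝ v w + γ / 2 * ‖w - z‖ ^ 2 : ℝ) : EReal) + π w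
  differentiable : Differentiable ℝ g
  convex : ConvexOn ℝ univ g
  min_mem : π xm ≠ ⊤
  isMin : ∀ w, π w ≠ ⊤ → g xm + (π xm).toReal ≤ g w + (π w).toReal
  radius_nonneg : 0 ≤ D
  lip_nonneg : 0 ≤ M
  lip : ∀ u ∈ Metric.closedBall xm D, ∀ v ∈ Metric.closedBall xm D,
    ‖gradient g u - gradient g v‖ ≤ M * ‖u - v‖

lemma Differentiable.hasFDerivAt_inner_gradient {d : ℕ} {g : Eucl d → ℝ} (hg : Differentiable ℝ g)
    (x : Eucl d) : HasFDerivAt g (innerSL ℝ (gradient g x)) x :=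
  (hg x).hasGradientAt.hasFDerivAt

/-- The choice of `α₁` gives `b = μ`, which kills the linear term of the quadratic; its positive
root then reproduces `b = μ` at the next iteration. -/
lemma AGLSTrial.alpha_eq {d : ℕ} {g : Eucl d → ℝ} {π : Eucl d → EReal} {μ : ℝ} {t : ℕ}
    {s s' : AGLSState d} (hμ : 0 < μ) (h : AGLSTrial g π μ t s s') (hL : 0 < s'.Lhat)
    (hs : t ≠ 1 → s.α ^ 2 * (s.Lhat + μ) = μ) : s'.α = √(μ / (s'.Lhat + μ)) := by
  by_cases ht : t = 1
  · exact h.weight_first ht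
  · obtain ⟨hpos, heq⟩ := h.weight_later ht
    rw [hs ht, sub_self, zero_mul, add_zero] at heq
    have : μ / (s'.Lhat + μ) = s'.α ^ 2 := by
      rw [div_eq_iff (by positivity)]; linarith
    rw [this, Real.sqrt_sq hpos.le]

lemma agls_weight {μ L : ℝ} (hμ : 0 < μ) (hL : 0 < L) :
    0 < √(μ / (L + μ)) ∧ √(μ / (L + μ)) < 1 ∧ √(μ / (L + μ)) ^ 2 * (L + μ) = μ := by
  refine ⟨Real.sqrt_pos.2 (by positivity), ?_, ?_⟩
  · rw [Real.sqrt_lt' one_pos, one_pow, div_lt_one (by positivity)]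
    linarith
  · rw [Real.sq_sqrt (by positivity)]
    field_simp

/-- The energy `ψ(y) - ψ(w) + (μ/2)‖w - z‖²` for `ψ = g + π`. -/
noncomputable def AGLSState.energy {d : ℕ} (g : Eucl d → ℝ) (π : Eucl d → EReal) (μ : ℝ) (w : Eucl d)
    (s : AGLSState d) : ℝ :=
  g s.y + (π s.y).toReal - (g w + (π w).toReal) + μ / 2 * ‖w - s.z‖ ^ 2

/-- The algebraic relations between the weights of an AGLS trial. -/
structure AGLSState.Balanced {d : ℕ} (μ : ℝ) (s : AGLSState d) : Prop where
  alpha_eq : s.α = √(μ / (s.Lhat + μ))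
  alpha_pos : 0 < s.α
  alpha_lt : s.α < 1
  alpha_sq : s.α ^ 2 * (s.Lhat + μ) = μ
  alpha_gamma : s.α * s.γ = μ * (1 - s.α)
  gamma_nonneg : 0 ≤ s.γ
  beta_eq : s.β * (1 + s.α) = 1

section

variable {d : ℕ} {g : Eucl d → ℝ} {π : Eucl d → EReal} {μ : ℝ} {t : ℕ} {s s' : AGLSState d}

lemma AGLSTrial.balanced (hμ : 0 < μ) (h : AGLSTrial g π μ t s s') (hL : 0 < s'.Lhat)
    (hs : t ≠ 1 → s.α ^ 2 * (s.Lhat + μ) = μ) : s'.Balanced μ := by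
  have hα := h.alpha_eq hμ hL hs
  obtain ⟨h0, h1, h2⟩ := agls_weight hμ hL
  rw [← hα] at h0 h1 h2
  have hαγ : s'.α * s'.γ = μ * (1 - s'.α) := by rw [h.gamma_eq]; linear_combination h2
  have hγ : 0 ≤ s'.γ := by
    have : 0 ≤ s'.α * s'.γ := by rw [hαγ]; exact mul_nonneg hμ.le (by linarith)
    exact nonneg_of_mul_nonneg_right this h0
  refine ⟨hα, h0, h1, h2, hαγ, hγ, ?_⟩
  rw [h.beta_eq, div_mul_eq_mul_div, div_eq_one_iff_eq (by positivity)]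
  apply mul_left_cancel₀ h0.ne'
  linear_combination (1 + s'.α) * hαγ - h2

lemma toReal_le_of_coe_add_le {a b : ℝ} {x y : EReal} (hx : x ≠ ⊥) (hxt : x ≠ ⊤) (hy : y ≠ ⊤)
    (hyb : y ≠ ⊥) (h : (a : EReal) + x ≤ (b : EReal) + y) : a + x.toReal ≤ b + y.toReal := by
  lift x to ℝ using ⟨hxt, hx⟩
  lift y to ℝ using ⟨hy, hyb⟩
  simpa [← EReal.coe_add, -EReal.coe_add] using! (by exact_mod_cast h : a + x ≤ b + y)

lemma ne_top_of_coe_add_le {a b : ℝ} {x y : EReal} (hy : y ≠ ⊤)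
    (h : (a : EReal) + x ≤ (b : EReal) + y) : x ≠ ⊤ := by
  rw [← add_sq_ne_top_iff (b := a)]
  exact ne_top_of_le_ne_top (add_sq_ne_top_iff.2 hy) h

variable {xm : Eucl d} {D M : ℝ}

lemma AGLSModel.exists_trial (hm : AGLSModel g π μ xm D M) (t : ℕ) (s : AGLSState d) {L : ℝ}
    (hL : 0 < L) (hs : t ≠ 1 → s.α ^ 2 * (s.Lhat + μ) = μ) :
    ∃ s' : AGLSState d, s'.Lhat = L ∧ AGLSTrial g π μ t s s' := by
  obtain ⟨h0, h1, h2⟩ := agls_weight hm.mu_pos hL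
  set α := √(μ / (L + μ)) with hα
  set γ := (L + μ) * α - μ with hγ
  set β := γ / (L * α) with hβ
  set x := (1 - α) • s.y + α • ((1 - β) • s.y + β • s.z) with hx
  have hγ0 : 0 ≤ γ := by
    have : 0 ≤ α * γ := by
      rw [show α * γ = μ * (1 - α) by rw [hγ]; linear_combination h2]
      exact mul_nonneg hm.mu_pos.le (by linarith)
    exact nonneg_of_mul_nonneg_right this h0
  obtain ⟨z, hz⟩ := hm.exists_argmin (gradient g x) s.z γ hγ0
  refine ⟨⟨x, (1 - α) • s.y + α • z, z, L, α, β, γ⟩, rfl, ⟨fun _ => rfl, fun ht => ⟨h0, ?_⟩, rfl,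
    rfl, rfl, hz, rfl⟩⟩
  rw [hs ht]
  linear_combination h2

lemma AGLSTrial.z_ne_top (h : AGLSTrial g π μ t s s') (hz : π s.z ≠ ⊤) : π s'.z ≠ ⊤ :=
  ne_top_of_coe_add_le hz (h.z_argmin s.z)

lemma AGLSModel.y_ne_top (hm : AGLSModel g π μ xm D M) (h : AGLSTrial g π μ t s s')
    (hb : s'.Balanced μ) (hy : π s.y ≠ ⊤) (hz : π s.z ≠ ⊤) : π s'.y ≠ ⊤ := by
  rw [h.y_eq]
  exact hm.strongConvex.1 hy (h.z_ne_top hz) (by linarith [hb.alpha_lt]) hb.alpha_pos.le (by ring)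

/-- The proximal step, with the quadratic growth of its strongly convex objective. -/
lemma AGLSModel.prox_le (hm : AGLSModel g π μ xm D M) (h : AGLSTrial g π μ t s s')
    (hz : π s.z ≠ ⊤) {w : Eucl d} (hw : π w ≠ ⊤) :
    inner ℝ (gradient g s'.x) s'.z + s'.γ / 2 * ‖s'.z - s.z‖ ^ 2 + (π s'.z).toReal
        + (μ + s'.γ) / 2 * ‖w - s'.z‖ ^ 2
      ≤ inner ℝ (gradient g s'.x) w + s'.γ / 2 * ‖w - s.z‖ ^ 2 + (π w).toReal := by
  have hsc := (hm.strongConvex.add_inner (gradient g s'.x)).add_sq (m := s'.γ) s.z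
  have hz' := h.z_ne_top hz
  have := hsc.add_sq_le_of_isMin hz' hw (fun u hu => by
    have := toReal_le_of_coe_add_le (hm.ne_bot _) hz' hu (hm.ne_bot _) (h.z_argmin u)
    linarith)
  linarith

lemma AGLSTrial.y_sub_x (h : AGLSTrial g π μ t s s') :
    s'.y - s'.x = s'.α • (s'.z - ((1 - s'.β) • s.y + s'.β • s.z)) := by
  rw [h.y_eq, h.x_eq]; module

lemma AGLSModel.add_inner_le (hm : AGLSModel g π μ xm D M) (x w : Eucl d) :
    g x + inner ℝ (gradient g x) (w - x) ≤ g w := by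
  simpa using hm.convex.add_fderiv_le (hm.differentiable.hasFDerivAt_inner_gradient x) w

/-- An accepted step contracts the energy. -/
lemma AGLSModel.energy_le (hm : AGLSModel g π μ xm D M) (h : AGLSTrial g π μ t s s')
    (hb : s'.Balanced μ) (hy : π s.y ≠ ⊤) (hz : π s.z ≠ ⊤)
    (hdesc : g s'.y ≤ g s'.x + inner ℝ (gradient g s'.x) (s'.y - s'.x)
      + s'.Lhat / 2 * ‖s'.y - s'.x‖ ^ 2) {w : Eucl d} (hw : π w ≠ ⊤) :
    s'.energy g π μ w ≤ (1 - s'.α) * s.energy g π μ w := by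
  have h0 := hb.alpha_pos
  have h1 : 0 < 1 - s'.α := by linarith [hb.alpha_lt]
  have ha := mul_le_mul_of_nonneg_left (hm.add_inner_le s'.x s.y) h1.le
  have hbw := mul_le_mul_of_nonneg_left (hm.add_inner_le s'.x w) h0.le
  have hp := mul_le_mul_of_nonneg_left (hm.prox_le h hz hw) h0.le
  have hc := hm.strongConvex.2 hy (h.z_ne_top hz) h1.le h0.le (by ring)
  rw [← h.y_eq] at hc
  simp only [smul_eq_mul] at hc
  have hu := norm_sq_convex_comb_sub s.y s.z s'.z (a := 1 - s'.β) (b := s'.β) (by ring)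
  have hβ0 : 0 ≤ s'.β := by
    by_contra hneg
    nlinarith [hb.beta_eq]
  have hβ1 : 0 ≤ 1 - s'.β := by nlinarith [hb.beta_eq]
  have hu2 : ‖s'.z - ((1 - s'.β) • s.y + s'.β • s.z)‖ ^ 2
      ≤ (1 - s'.β) * ‖s.y - s'.z‖ ^ 2 + s'.β * ‖s'.z - s.z‖ ^ 2 := by
    rw [norm_sub_rev, hu, norm_sub_rev s'.z s.z]
    have := mul_nonneg (mul_nonneg hβ1 hβ0) (sq_nonneg ‖s.y - s.z‖)
    linarith
  have hyx : ‖s'.y - s'.x‖ ^ 2 = s'.α ^ 2 * ‖s'.z - ((1 - s'.β) • s.y + s'.β • s.z)‖ ^ 2 := by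
    rw [h.y_sub_x, norm_smul, mul_pow, Real.norm_eq_abs, sq_abs]
  have hL : s'.Lhat * s'.α ^ 2 = μ * (1 - s'.α) * (1 + s'.α) := by
    linear_combination hb.alpha_sq
  -- `L̂α² = μ(1 - α²)`, and `β = 1/(1+α)` splits the square with weights `α` and `1` after
  -- multiplication by `1 + α`. The first part is cancelled by the strong convexity of `π` between
  -- `y` and the new `z`, the second by the proximal term.
  have hquad : s'.Lhat / 2 * ‖s'.y - s'.x‖ ^ 2
      ≤ μ / 2 * (1 - s'.α) * (s'.α * ‖s.y - s'.z‖ ^ 2 + ‖s'.z - s.z‖ ^ 2) := by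
    have e : s'.Lhat / 2 * ‖s'.y - s'.x‖ ^ 2 = μ / 2 * (1 - s'.α) * ((1 + s'.α)
        * ‖s'.z - ((1 - s'.β) • s.y + s'.β • s.z)‖ ^ 2) := by
      rw [hyx]
      linear_combination (1 / 2) * ‖s'.z - ((1 - s'.β) • s.y + s'.β • s.z)‖ ^ 2 * hL
    rw [e]
    refine mul_le_mul_of_nonneg_left ?_ (mul_nonneg (by linarith [hm.mu_pos]) h1.le)
    refine (mul_le_mul_of_nonneg_left hu2 (by linarith : 0 ≤ 1 + s'.α)).trans (le_of_eq ?_)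
    linear_combination (‖s'.z - s.z‖ ^ 2 - ‖s.y - s'.z‖ ^ 2) * hb.beta_eq
  have hin : inner ℝ (gradient g s'.x) (s'.y - s'.x)
      = (1 - s'.α) * inner ℝ (gradient g s'.x) (s.y - s'.x)
        + s'.α * (inner ℝ (gradient g s'.x) s'.z - inner ℝ (gradient g s'.x) s'.x) := by
    rw [h.y_eq, ← inner_sub_right, ← inner_smul_right, ← inner_smul_right, ← inner_add_right]
    congr 1
    module
  rw [hin] at hdesc
  rw [inner_sub_right] at hbw
  have hsplit : s'.α * (s'.γ / 2 * ‖s'.z - s.z‖ ^ 2)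
      = μ / 2 * (1 - s'.α) * ‖s'.z - s.z‖ ^ 2 := by
    linear_combination (1 / 2) * ‖s'.z - s.z‖ ^ 2 * hb.alpha_gamma
  have hsplit2 : s'.α * (s'.γ / 2 * ‖w - s.z‖ ^ 2) = μ / 2 * (1 - s'.α) * ‖w - s.z‖ ^ 2 := by
    linear_combination (1 / 2) * ‖w - s.z‖ ^ 2 * hb.alpha_gamma
  have hsplit3 : s'.α * ((μ + s'.γ) / 2 * ‖w - s'.z‖ ^ 2) = μ / 2 * ‖w - s'.z‖ ^ 2 := by
    linear_combination (1 / 2) * ‖w - s'.z‖ ^ 2 * hb.alpha_gamma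
  unfold AGLSState.energy
  nlinarith only [ha, hbw, hp, hc, hquad, hdesc, hsplit, hsplit2, hsplit3]

/-- Near the minimizer, every trial with a large enough estimate stays in the ball on which the
gradient is Lipschitz. -/
lemma AGLSModel.trial_mem_closedBall (hm : AGLSModel g π μ xm D M) (h : AGLSTrial g π μ t s s')
    (hb : s'.Balanced μ) (hz : π s.z ≠ ⊤) (hL : 3 * M ≤ s'.Lhat)
    (hyD : ‖s.y - xm‖ ≤ 3 / 4 * D) (hzD : ‖s.z - xm‖ ≤ 3 / 4 * D) :
    s'.x ∈ Metric.closedBall xm D ∧ s'.y ∈ Metric.closedBall xm D := by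
  have h0 := hb.alpha_pos
  have h1 : 0 < 1 - s'.α := by linarith [hb.alpha_lt]
  have hD := hm.radius_nonneg
  have hM := hm.lip_nonneg
  have hμ := hm.mu_pos
  have hβ0 : 0 ≤ s'.β := by
    by_contra hneg
    nlinarith [hb.beta_eq]
  have hβ1 : 0 ≤ 1 - s'.β := by nlinarith [hb.beta_eq]
  have conv := convex_closedBall xm (3 / 4 * D)
  have hxD : ‖s'.x - xm‖ ≤ 3 / 4 * D := by
    rw [← mem_closedBall_iff_norm] at hyD hzD ⊢
    rw [h.x_eq]
    exact conv hyD (conv hyD hzD hβ1 hβ0 (by ring)) h1.le h0.le (by ring)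
  have hxB : s'.x ∈ Metric.closedBall xm D := by
    rw [mem_closedBall_iff_norm]; linarith
  refine ⟨hxB, ?_⟩
  -- The proximal inequality at `xm` and the optimality of `xm` together bound the distance of the
  -- new `z` from `xm`, at the price of `‖∇g(x) - ∇g(xm)‖`.
  have hprox := hm.prox_le h hz hm.min_mem
  have hopt := hm.strongConvex.le_of_isMin_add hm.min_mem (h.z_ne_top hz)
    (hm.differentiable.hasFDerivAt_inner_gradient xm) hm.isMin
  have hlip := hm.lip s'.x hxB xm (Metric.mem_closedBall_self hD)
  set a := ‖s'.z - xm‖ with ha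
  have ha0 : 0 ≤ a := norm_nonneg _
  have hin : inner ℝ (gradient g xm - gradient g s'.x) (s'.z - xm) ≤ M * (3 / 4 * D) * a := by
    refine (real_inner_le_norm _ _).trans ?_
    rw [norm_sub_rev]
    exact mul_le_mul_of_nonneg_right (hlip.trans (mul_le_mul_of_nonneg_left hxD hM)) ha0
  have htri : (a - ‖s.z - xm‖) ^ 2 ≤ ‖s'.z - s.z‖ ^ 2 := by
    rw [← sq_abs]
    refine pow_le_pow_left₀ (abs_nonneg _) ?_ 2
    have := abs_norm_sub_norm_le (s'.z - xm) (s.z - xm)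
    rwa [sub_sub_sub_cancel_right] at this
  rw [norm_sub_rev xm s'.z, norm_sub_rev xm s.z] at hprox
  simp only [innerSL_apply_apply] at hopt
  rw [inner_sub_left, inner_sub_right, inner_sub_right] at hin
  rw [inner_sub_right] at hopt
  rw [← ha] at hprox
  have hγ := hb.gamma_nonneg
  have hmain : (μ + s'.γ) * a ^ 2 ≤ (s'.γ * (3 / 4 * D) + M * (3 / 4 * D)) * a := by
    have e1 : s'.γ * (a - ‖s.z - xm‖) ^ 2 ≤ s'.γ * ‖s'.z - s.z‖ ^ 2 :=
      mul_le_mul_of_nonneg_left htri hγ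
    have e2 : s'.γ * (‖s.z - xm‖ * a) ≤ s'.γ * ((3 / 4 * D) * a) :=
      mul_le_mul_of_nonneg_left (mul_le_mul_of_nonneg_right hzD ha0) hγ
    nlinarith only [e1, e2, hprox, hopt, hin]
  have hlin : (μ + s'.γ) * a ≤ s'.γ * (3 / 4 * D) + M * (3 / 4 * D) := by
    rcases ha0.eq_or_lt with h' | h'
    · rw [← h', mul_zero]; positivity
    · refine le_of_mul_le_mul_right ?_ h'
      linarith
  -- Multiplying `hlin` by `α²` turns `μ + γ` into `μ/α` times `α²`; `3M ≤ L̂` makes `α²M ≤ μ/3`.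
  have hαa : s'.α * a ≤ (s'.α * (1 - s'.α) + 1 / 3) * (3 / 4 * D) := by
    have e1 := mul_le_mul_of_nonneg_left hlin (sq_nonneg s'.α)
    have e2 : s'.α ^ 2 * ((μ + s'.γ) * a) = μ * (s'.α * a) := by
      linear_combination (s'.α * a) * hb.alpha_gamma
    have e3 : s'.α ^ 2 * M ≤ μ * (1 / 3) := by
      have := mul_le_mul_of_nonneg_left hL (sq_nonneg s'.α)
      nlinarith [hb.alpha_sq, mul_pos (pow_pos h0 2) hμ]
    have e4 : s'.α ^ 2 * s'.γ = μ * (s'.α * (1 - s'.α)) := by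
      linear_combination s'.α * hb.alpha_gamma
    have e5 := mul_le_mul_of_nonneg_right e3 (by positivity : 0 ≤ 3 / 4 * D)
    refine le_of_mul_le_mul_left ?_ hμ
    calc μ * (s'.α * a) ≤ s'.α ^ 2 * (s'.γ * (3 / 4 * D) + M * (3 / 4 * D)) := by rw [← e2]; exact e1
      _ = μ * (s'.α * (1 - s'.α)) * (3 / 4 * D) + s'.α ^ 2 * M * (3 / 4 * D) := by rw [← e4]; ring
      _ ≤ μ * (s'.α * (1 - s'.α)) * (3 / 4 * D) + μ * (1 / 3) * (3 / 4 * D) := by linarith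
      _ = μ * ((s'.α * (1 - s'.α) + 1 / 3) * (3 / 4 * D)) := by ring
  rw [mem_closedBall_iff_norm, h.y_eq,
    show (1 - s'.α) • s.y + s'.α • s'.z - xm = (1 - s'.α) • (s.y - xm) + s'.α • (s'.z - xm) by module]
  refine (norm_add_le _ _).trans ?_
  rw [norm_smul, norm_smul, Real.norm_of_nonneg h1.le, Real.norm_of_nonneg h0.le]
  -- The total factor is `(1-α) + α(1-α) + 1/3 = 4/3 - α²`, at most `4/3`, which matches the radius
  -- `3D/4`.
  have e6 := mul_le_mul_of_nonneg_left hyD h1.le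
  have e7 : 0 ≤ s'.α ^ 2 * D := by positivity
  nlinarith only [e6, e7, hαa]

/-- Both trial points lie in the ball, hence so does the segment between them, the only place where
the descent lemma needs the Lipschitz bound. -/
lemma AGLSModel.accepts (hm : AGLSModel g π μ xm D M) (h : AGLSTrial g π μ t s s')
    (hb : s'.Balanced μ) (hz : π s.z ≠ ⊤) (hL : 3 * M ≤ s'.Lhat)
    (hyD : ‖s.y - xm‖ ≤ 3 / 4 * D) (hzD : ‖s.z - xm‖ ≤ 3 / 4 * D) :
    AGLSAccepts g π μ t s s'.Lhat s' := by
  obtain ⟨hx, hy⟩ := hm.trial_mem_closedBall h hb hz hL hyD hzD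
  refine ⟨rfl, h, ?_⟩
  have := le_add_fderiv_add_sq (M := M) (x := s'.x) (y := s'.y)
    hm.differentiable.hasFDerivAt_inner_gradient (fun t ht => by
      have hmem : s'.x + t • (s'.y - s'.x) ∈ Metric.closedBall xm D := by
        have := convex_closedBall xm D hx hy (by linarith [ht.2] : 0 ≤ 1 - t) ht.1 (by ring)
        convert! this using 1
        module
      rw [← map_sub, innerSL_apply_norm]
      refine (hm.lip _ hmem _ hx).trans (le_of_eq ?_)
      rw [add_sub_cancel_left, norm_smul, Real.norm_of_nonneg ht.1])
  simp only [innerSL_apply_apply] at this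
  have hM := hm.lip_nonneg
  have : M / 2 * ‖s'.y - s'.x‖ ^ 2 ≤ s'.Lhat / 2 * ‖s'.y - s'.x‖ ^ 2 :=
    mul_le_mul_of_nonneg_right (by linarith) (sq_nonneg _)
  linarith

end

/-! ### Runs of AGLS -/

lemma AGLSModel.add_sq_le {d : ℕ} {g : Eucl d → ℝ} {π : Eucl d → EReal} {μ : ℝ} {xm : Eucl d}
    {D M : ℝ} (hm : AGLSModel g π μ xm D M) {w : Eucl d} (hw : π w ≠ ⊤) :
    g xm + (π xm).toReal + μ / 2 * ‖w - xm‖ ^ 2 ≤ g w + (π w).toReal := by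
  have h1 := hm.strongConvex.le_of_isMin_add hm.min_mem hw
    (hm.differentiable.hasFDerivAt_inner_gradient xm) hm.isMin
  have h2 := hm.add_inner_le xm w
  rw [innerSL_apply_apply] at h1
  linarith

/-- Invariants of the AGLS states. -/
structure AGLSState.Good {d : ℕ} (g : Eucl d → ℝ) (π : Eucl d → EReal) (μ : ℝ) (xm : Eucl d)
    (D Λ : ℝ) (t : ℕ) (s : AGLSState d) : Prop where
  y_ne_top : π s.y ≠ ⊤
  z_ne_top : π s.z ≠ ⊤
  Lhat_pos : 0 < s.Lhat
  Lhat_le : s.Lhat ≤ Λ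
  alpha_sq : t ≠ 0 → s.α ^ 2 * (s.Lhat + μ) = μ
  energy_le : s.energy g π μ xm ≤ μ / 2 * (3 / 4 * D) ^ 2

section

variable {d : ℕ} {g : Eucl d → ℝ} {π : Eucl d → EReal} {μ : ℝ} {xm : Eucl d} {D M Λ : ℝ} {t : ℕ}
  {s s' : AGLSState d} {τd τu : ℝ}

lemma AGLSModel.gap_nonneg (hm : AGLSModel g π μ xm D M) {w : Eucl d} (hw : π w ≠ ⊤) :
    0 ≤ g w + (π w).toReal - (g xm + (π xm).toReal) := by
  linarith [hm.isMin w hw]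

/-- Both parts of the energy are nonnegative; the gap part controls `y` by quadratic growth at `xm`,
the quadratic part controls `z`. -/
lemma AGLSModel.norm_sub_le_of_good (hm : AGLSModel g π μ xm D M) (hs : s.Good g π μ xm D Λ t) :
    ‖s.y - xm‖ ≤ 3 / 4 * D ∧ ‖s.z - xm‖ ≤ 3 / 4 * D := by
  have hE := hs.energy_le
  unfold AGLSState.energy at hE
  have hD : 0 ≤ 3 / 4 * D := by linarith [hm.radius_nonneg]
  have hμ : 0 < μ / 2 := by linarith [hm.mu_pos]
  have h1 := hm.add_sq_le hs.y_ne_top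
  have h2 := mul_nonneg hμ.le (sq_nonneg ‖xm - s.z‖)
  have h3 := hm.isMin _ hs.y_ne_top
  constructor
  · refine (sq_le_sq₀ (norm_nonneg _) hD).1 ?_
    exact le_of_mul_le_mul_left (by linarith) hμ
  · rw [norm_sub_rev]
    refine (sq_le_sq₀ (norm_nonneg _) hD).1 ?_
    exact le_of_mul_le_mul_left (by linarith) hμ

lemma AGLSModel.exists_accepts (hm : AGLSModel g π μ xm D M) (hs : s.Good g π μ xm D Λ t) {L : ℝ}
    (hL : 0 < L) (hLM : 3 * M ≤ L) : ∃ s', AGLSAccepts g π μ (t + 1) s L s' := by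
  have hα : t + 1 ≠ 1 → s.α ^ 2 * (s.Lhat + μ) = μ := fun h => hs.alpha_sq (by omega)
  obtain ⟨s', rfl, hs'⟩ := hm.exists_trial (t + 1) s hL hα
  obtain ⟨hy, hz⟩ := hm.norm_sub_le_of_good hs
  exact ⟨s', hm.accepts hs' (hs'.balanced hm.mu_pos hL hα) hs.z_ne_top hLM hy hz⟩

lemma AGLSModel.exists_step (hm : AGLSModel g π μ xm D M) (hs : s.Good g π μ xm D Λ t)
    (hτd : 0 < τd) (hτu : 1 < τu) : ∃ s', AGLSStep g π μ τd τu (t + 1) s s' := by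
  have hpos : 0 < τd * s.Lhat := mul_pos hτd hs.Lhat_pos
  have hne : ∃ j : ℕ, ∃ s'', AGLSAccepts g π μ (t + 1) s (τd * s.Lhat * τu ^ j) s'' := by
    obtain ⟨j, hj⟩ := pow_unbounded_of_one_lt (3 * M / (τd * s.Lhat)) hτu
    rw [div_lt_iff₀' hpos] at hj
    exact ⟨j, hm.exists_accepts hs (by positivity) hj.le⟩
  classical
  obtain ⟨s', hs'⟩ := Nat.find_spec hne
  exact ⟨s', Nat.find hne, ⟨Nat.find_spec hne, fun j hj => Nat.find_min' hne hj⟩, hs'⟩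

lemma AGLSModel.good_of_step (hm : AGLSModel g π μ xm D M) (hs : s.Good g π μ xm D Λ t)
    (hτd : 0 < τd) (hτd1 : τd < 1) (hτu : 1 < τu) (hΛ : 3 * M * τu ≤ Λ)
    (h : AGLSStep g π μ τd τu (t + 1) s s') :
    s'.Good g π μ xm D Λ (t + 1) ∧
      s'.energy g π μ xm ≤ (1 - √(μ / (s'.Lhat + μ))) * s.energy g π μ xm := by
  obtain ⟨k, hk, hL, htr, hdesc⟩ := h
  have hpos : 0 < τd * s.Lhat := mul_pos hτd hs.Lhat_pos
  have hτu0 : 0 < τu := by linarith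
  have hL0 : 0 < s'.Lhat := by rw [hL]; positivity
  have hα : t + 1 ≠ 1 → s.α ^ 2 * (s.Lhat + μ) = μ := fun h => hs.alpha_sq (by omega)
  have hb := htr.balanced hm.mu_pos hL0 hα
  rw [← hL] at hdesc
  have hE := hm.energy_le htr hb hs.y_ne_top hs.z_ne_top hdesc hm.min_mem
  have hE0 : 0 ≤ s.energy g π μ xm := by
    unfold AGLSState.energy
    have := mul_nonneg hm.mu_pos.le (sq_nonneg ‖xm - s.z‖)
    linarith [hm.isMin _ hs.y_ne_top]
  have hLe : s'.Lhat ≤ Λ := by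
    rw [hL]
    rcases Nat.eq_zero_or_pos k with rfl | hkpos
    · rw [pow_zero, mul_one]
      have := hs.Lhat_le
      nlinarith [hs.Lhat_pos]
    -- The previous exponent `j` was rejected, so its estimate is below `3M`; one more factor `τu`
    -- stays below `Λ`.
    · obtain ⟨j, rfl⟩ : ∃ j, k = j + 1 := ⟨k - 1, by omega⟩
      have hlt : τd * s.Lhat * τu ^ j < 3 * M := by
        by_contra hge
        have := hk.2 (hm.exists_accepts hs (by positivity) (not_lt.1 hge))
        omega
      have := mul_le_mul_of_nonneg_right hlt.le hτu0.le
      rw [pow_succ]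
      linarith
  rw [← hb.alpha_eq]
  refine ⟨⟨hm.y_ne_top htr hb hs.y_ne_top hs.z_ne_top, htr.z_ne_top hs.z_ne_top, hL0, hLe,
    fun _ => hb.alpha_sq, ?_⟩, hE⟩
  have := mul_le_mul_of_nonneg_right (by linarith [hb.alpha_pos] : 1 - s'.α ≤ 1) hE0
  linarith [hs.energy_le]

/-- Quadratic growth bounds `(μ/2)‖x0 - xm‖²` by the gap. The constant `8` makes twice the gap at
most `μD²/4`, below the allowed `9μD²/32`. -/
lemma AGLSModel.good_init (hm : AGLSModel g π μ xm D M) {x0 : Eucl d} (hx0 : π x0 ≠ ⊤) {L0 : ℝ}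
    (hL0 : 0 < L0) (hΛ : L0 ≤ Λ)
    (hD : 8 / μ * (g x0 + (π x0).toReal - (g xm + (π xm).toReal)) ≤ D ^ 2) :
    (AGLSState.init x0 L0).Good g π μ xm D Λ 0 ∧ (AGLSState.init x0 L0).energy g π μ xm
      ≤ 2 * (g x0 + (π x0).toReal - (g xm + (π xm).toReal)) := by
  have h1 := hm.add_sq_le hx0
  have hE : (AGLSState.init x0 L0).energy g π μ xm
      ≤ 2 * (g x0 + (π x0).toReal - (g xm + (π xm).toReal)) := by
    simp only [AGLSState.energy, AGLSState.init]
    rw [norm_sub_rev]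
    linarith
  refine ⟨⟨hx0, hx0, hL0, hΛ, fun h => absurd rfl h, hE.trans ?_⟩, hE⟩
  have hμ := hm.mu_pos
  rw [div_mul_eq_mul_div, div_le_iff₀ hμ] at hD
  nlinarith [mul_nonneg hμ.le (sq_nonneg D)]

lemma agls_prod_le {μ Λ : ℝ} (hμ : 0 < μ) {l : ℕ → ℝ} {t : ℕ}
    (hl : ∀ i ∈ Finset.Icc 1 t, 0 < l i ∧ l i ≤ Λ) :
    ∏ i ∈ Finset.Icc 1 t, (1 - √(μ / (l i + μ))) ≤ Real.exp (-(√(μ / (Λ + μ)) * t)) := by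
  calc ∏ i ∈ Finset.Icc 1 t, (1 - √(μ / (l i + μ)))
      ≤ ∏ _i ∈ Finset.Icc 1 t, Real.exp (-√(μ / (Λ + μ))) := by
        refine Finset.prod_le_prod (fun i hi => ?_) (fun i hi => ?_)
        · linarith [(agls_weight hμ (hl i hi).1).2.1]
        · have h1 : √(μ / (Λ + μ)) ≤ √(μ / (l i + μ)) := by
            have := hl i hi
            apply Real.sqrt_le_sqrt
            gcongr
            · linarith
            · linarith
          linarith [Real.add_one_le_exp (-√(μ / (Λ + μ)))]
    _ = Real.exp (-(√(μ / (Λ + μ)) * t)) := by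
        rw [Finset.prod_const, Nat.card_Icc, Nat.add_sub_cancel, ← Real.exp_nat_mul]
        congr 1
        ring

lemma exp_neg_le_quarter {a : ℝ} (ha : 2 ≤ a) : Real.exp (-a) ≤ 1 / 4 := by
  have h1 : (2 : ℝ) ≤ Real.exp 1 := by linarith [Real.add_one_le_exp (1 : ℝ)]
  have h2 : (4 : ℝ) ≤ Real.exp a := by
    calc (4 : ℝ) = 2 * 2 := by norm_num
      _ ≤ Real.exp 1 * Real.exp 1 := by gcongr
      _ = Real.exp 2 := by rw [← Real.exp_add]; norm_num
      _ ≤ Real.exp a := Real.exp_le_exp.2 ha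
  rw [Real.exp_neg, inv_eq_one_div]
  exact one_div_le_one_div_of_le (by norm_num) h2

variable {x0 : Eucl d} {L0 : ℝ}

/-- AGLS with early stop has a run. -/
lemma AGLSModel.exists_run (hm : AGLSModel g π μ xm D M) (hx0 : π x0 ≠ ⊤) (hL0 : 0 < L0)
    (hτd : 0 < τd) (hτd1 : τd < 1) (hτu : 1 < τu)
    (hD : 8 / μ * (g x0 + (π x0).toReal - (g xm + (π xm).toReal)) ≤ D ^ 2) :
    ∃ s T, IsAGLSRun g π μ L0 τd τu x0 s T := by
  classical
  set Λ := max L0 (3 * M * τu) with hΛ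
  -- The default value is never reached: a good state has a successor, and the successor is good.
  let nxt : ℕ → AGLSState d → AGLSState d := fun t s =>
    if h : ∃ s', AGLSStep g π μ τd τu (t + 1) s s' then h.choose else s
  let st : ℕ → AGLSState d := fun n => Nat.rec (AGLSState.init x0 L0) nxt n
  have hstep : ∀ t, (st t).Good g π μ xm D Λ t → AGLSStep g π μ τd τu (t + 1) (st t) (st (t + 1)) := by
    intro t ht
    have h := hm.exists_step ht hτd hτu
    have e : st (t + 1) = h.choose := dif_pos h
    rw [e]
    exact h.choose_spec
  have hgood : ∀ t, (st t).Good g π μ xm D Λ t := by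
    intro t
    induction t with
    | zero => exact (hm.good_init hx0 hL0 (le_max_left _ _) hD).1
    | succ t ih => exact (hm.good_of_step ih hτd hτd1 hτu (le_max_right _ _) (hstep t ih)).1
  have hμ := hm.mu_pos
  have hΛ0 : 0 < Λ := hL0.trans_le (le_max_left _ _)
  have hq := (agls_weight hμ hΛ0).1
  have hterm : ∃ t : ℕ, 1 ≤ t ∧ ∏ i ∈ Finset.Icc 1 t, (1 - √(μ / ((st i).Lhat + μ))) ≤ 1 / 4 := by
    obtain ⟨n, hn⟩ := exists_nat_ge (2 / √(μ / (Λ + μ)))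
    rw [div_le_iff₀' hq] at hn
    refine ⟨n, ?_, ?_⟩
    · rcases Nat.eq_zero_or_pos n with rfl | h
      · norm_num at hn
      · exact h
    · exact (agls_prod_le hμ fun i _ => ⟨(hgood i).Lhat_pos, (hgood i).Lhat_le⟩).trans
        (exp_neg_le_quarter hn)
  refine ⟨st, Nat.find hterm, rfl, fun t ht _ => ?_, Nat.find_spec hterm,
    fun j hj => Nat.find_min' hterm hj⟩
  obtain ⟨j, rfl⟩ : ∃ j, t = j + 1 := ⟨t - 1, by omega⟩
  exact hstep j (hgood j)

/-- The number of AGLS iterations, and the accuracy of the output. -/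
lemma AGLSModel.run_bound (hm : AGLSModel g π μ xm D M) (hx0 : π x0 ≠ ⊤) (hL0 : 0 < L0)
    (hτd : 0 < τd) (hτd1 : τd < 1) (hτu : 1 < τu)
    (hD : 8 / μ * (g x0 + (π x0).toReal - (g xm + (π xm).toReal)) ≤ D ^ 2)
    (hΛ0 : L0 ≤ Λ) (hΛ : 3 * M * τu ≤ Λ) {st : ℕ → AGLSState d} {T : ℕ}
    (hrun : IsAGLSRun g π μ L0 τd τu x0 st T) :
    π (st T).y ≠ ⊤ ∧ (T : ℝ) ≤ 1 + 2 * √((Λ + μ) / μ) ∧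
      g (st T).y + (π (st T).y).toReal - (g xm + (π xm).toReal)
        ≤ (g x0 + (π x0).toReal - (g xm + (π xm).toReal)) / 2 := by
  obtain ⟨h0, hstep, hT, hmin⟩ := hrun
  have hμ := hm.mu_pos
  obtain ⟨hg0, hE0⟩ := hm.good_init hx0 hL0 hΛ0 hD
  have hinv : ∀ t ≤ T, (st t).Good g π μ xm D Λ t ∧ (st t).energy g π μ xm
      ≤ (∏ i ∈ Finset.Icc 1 t, (1 - √(μ / ((st i).Lhat + μ)))) * (st 0).energy g π μ xm := by
    intro t
    induction t with
    | zero => intro _; rw [h0]; exact ⟨hg0, by simp⟩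
    | succ t ih =>
      intro ht
      obtain ⟨ihg, ihE⟩ := ih (by omega)
      have hs := hstep (t + 1) (by omega) ht
      rw [Nat.add_sub_cancel] at hs
      obtain ⟨h1, h2⟩ := hm.good_of_step ihg hτd hτd1 hτu hΛ hs
      refine ⟨h1, h2.trans ?_⟩
      rw [Finset.prod_Icc_succ_top (by omega), mul_comm (∏ i ∈ _, _), mul_assoc]
      exact mul_le_mul_of_nonneg_left ihE (by linarith [(agls_weight hμ h1.Lhat_pos).2.1])
  obtain ⟨hgT, hET⟩ := hinv T le_rfl
  have hgap := hm.gap_nonneg hx0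
  refine ⟨hgT.y_ne_top, ?_, ?_⟩
  · have hΛpos : 0 < Λ := hL0.trans_le hΛ0
    have hq := (agls_weight hμ hΛpos).1
    have hinvq : √((Λ + μ) / μ) = 1 / √(μ / (Λ + μ)) := by
      rw [← inv_div, Real.sqrt_inv, one_div]
    rw [hinvq]
    by_contra hlt
    rw [not_le] at hlt
    -- If `T` exceeded the bound, the stopping test would already hold at `T - 1`. The summand `1`
    -- absorbs this shift, and minimality needs `T - 1 ≥ 1`.
    have hT2 : 1 ≤ T - 1 := by
      by_contra h
      have hT1 : T = 1 := by have := hT.1; omega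
      rw [hT1, Nat.cast_one] at hlt
      have : 0 < 1 / √(μ / (Λ + μ)) := by positivity
      linarith
    have hcast : ((T - 1 : ℕ) : ℝ) = T - 1 := by
      rw [Nat.cast_sub hT.1, Nat.cast_one]
    have hge : 2 ≤ √(μ / (Λ + μ)) * ((T - 1 : ℕ) : ℝ) := by
      rw [hcast, ← div_le_iff₀' hq]
      have : 2 / √(μ / (Λ + μ)) = 2 * (1 / √(μ / (Λ + μ))) := by ring
      linarith
    have := hmin (show T - 1 ∈ _ from ⟨hT2, (agls_prod_le hμ (Λ := Λ) fun i hi => by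
      have hi' := Finset.mem_Icc.1 hi
      have := (hinv i (by omega)).1
      exact ⟨this.Lhat_pos, this.Lhat_le⟩).trans (exp_neg_le_quarter hge)⟩)
    have := hT.1
    omega
  -- The energy is quartered and started at no more than twice the gap, so the final gap is at most
  -- half the initial one.
  · have h1 : (st T).energy g π μ xm ≤ 1 / 4 * (st 0).energy g π μ xm := by
      refine hET.trans (mul_le_mul_of_nonneg_right hT.2 ?_)
      rw [h0]
      unfold AGLSState.energy
      have := mul_nonneg hμ.le (sq_nonneg ‖xm - (AGLSState.init x0 L0).z‖)
      have := hm.gap_nonneg hg0.y_ne_top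
      linarith
    rw [h0] at h1
    have h2 := mul_nonneg hμ.le (sq_nonneg ‖xm - (st T).z‖)
    have h3 : g (st T).y + (π (st T).y).toReal - (g xm + (π xm).toReal)
      ≤ (st T).energy g π μ xm := by unfold AGLSState.energy; linarith
    linarith

end

/-! ### The proximal subproblems of AGLS-SIPP -/

/-- A smoothed composite problem `fs + r` with `fs` smooth and `ρ`-weakly convex. -/
structure SmoothedProblem {d : ℕ} (fs : Eucl d → ℝ) (r : Eucl d → EReal) (ρ : ℝ) : Prop where
  rho_pos : 0 < ρ
  differentiable : Differentiable ℝ fs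
  weaklyConvex : IsWeaklyConvex ρ fs
  bddBelow : ∃ a : ℝ, ∀ x, a ≤ fs x
  convex : IsConvexExt r
  lsc : LowerSemicontinuous r
  reg_bddBelow : ∃ a : ℝ, ∀ x, (a : EReal) ≤ r x

section

variable {d : ℕ} {f fs : Eucl d → ℝ} {r : Eucl d → EReal} {ρ : ℝ}

lemma SmoothedProblem.ne_bot (h : SmoothedProblem fs r ρ) (x : Eucl d) : r x ≠ ⊥ := by
  obtain ⟨a, ha⟩ := h.reg_bddBelow
  exact ne_bot_of_coe_le ha x

/-- `xb` minimizes `fs + r + ρ‖· - x‖²`. -/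
structure IsProxPoint (fs : Eucl d → ℝ) (r : Eucl d → EReal) (ρ : ℝ) (x xb : Eucl d) : Prop where
  ne_top : r xb ≠ ⊤
  isMin : ∀ w, r w ≠ ⊤ → fs xb + (r xb).toReal + ρ * ‖xb - x‖ ^ 2
    ≤ fs w + (r w).toReal + ρ * ‖w - x‖ ^ 2

lemma exists_isProxPoint {a : ℝ} (hf : Continuous f) (ha : ∀ x, a ≤ f x)
    (hlsc : LowerSemicontinuous r) {b : ℝ} (hb : ∀ x, (b : EReal) ≤ r x) (hρ : 0 < ρ) {x0 : Eucl d}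
    (hx0 : r x0 ≠ ⊤) (x : Eucl d) : ∃ xb, IsProxPoint f r ρ x xb := by
  obtain ⟨z, hz, hmin⟩ := exists_argmin_coe_add (q := fun w => f w + ρ * ‖w - x‖ ^ 2) (c := ρ)
    (b := a) (p := x) (by fun_prop) hlsc hb hx0 hρ (fun w => by linarith [ha w])
  refine ⟨z, hz, fun w hw => ?_⟩
  have := toReal_le_of_coe_add_le (ne_bot_of_coe_le hb z) hz hw (ne_bot_of_coe_le hb w) (hmin w)
  linarith

lemma SmoothedProblem.exists_prox (h : SmoothedProblem fs r ρ) {x : Eucl d} (hx : r x ≠ ⊤) :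
    ∃ xb, IsProxPoint fs r ρ x xb := by
  obtain ⟨a, ha⟩ := h.bddBelow
  obtain ⟨b, hb⟩ := h.reg_bddBelow
  exact exists_isProxPoint h.differentiable.continuous ha h.lsc hb h.rho_pos hx x

/-- The penalty has curvature `2ρ`; half of it compensates for the weak convexity of `fs`, and
`ρ`-strong convexity remains. -/
lemma SmoothedProblem.add_sq_le_of_isProxPoint (h : SmoothedProblem fs r ρ) {x xb w : Eucl d}
    (hb : IsProxPoint fs r ρ x xb) (hw : r w ≠ ⊤) :
    fs xb + (r xb).toReal + ρ * ‖xb - x‖ ^ 2 + ρ / 2 * ‖w - xb‖ ^ 2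
      ≤ fs w + (r w).toReal + ρ * ‖w - x‖ ^ 2 := by
  have hr := h.convex.convexOn_toReal h.ne_bot
  have h1 : ConvexOn ℝ {x | r x ≠ ⊤} (fun w => fs w + ρ / 2 * ‖w - x‖ ^ 2) :=
    (h.weaklyConvex.add_sq_sub x).subset (subset_univ _) hr.1
  have h2 := (h1.add hr).strongConvexOn_add_sq (m := ρ) x
  have := h2.add_sq_le_of_isMin hb.ne_top hw (fun u hu => by
    have := hb.isMin u hu
    simp only [Pi.add_apply]
    linarith)
  simp only [Pi.add_apply] at this
  linarith

lemma toReal_add_coe {y : EReal} {b : ℝ} (hyt : y ≠ ⊤) (hyb : y ≠ ⊥) :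
    (y + (b : EReal)).toReal = y.toReal + b := by
  lift y to ℝ using ⟨hyt, hyb⟩
  rfl

lemma hasGradientAt_add_sq (hf : Differentiable ℝ fs) (x u : Eucl d) :
    HasGradientAt (fun w => fs w + ρ / 2 * ‖w - x‖ ^ 2) (gradient fs u + ρ • (u - x)) u := by
  rw [hasGradientAt_iff_hasFDerivAt]
  have h1 : HasFDerivAt fs (innerSL ℝ (gradient fs u)) u := hf.hasFDerivAt_inner_gradient u
  have h2 := (((hasFDerivAt_id (𝕜 := ℝ) u).sub_const x).norm_sq).const_mul (ρ / 2)
  refine (h1.add h2).congr_fderiv ?_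
  ext v
  simp
  ring

/-- The subproblem is an instance of the AGLS model. -/
lemma SmoothedProblem.aglsModel (h : SmoothedProblem fs r ρ) {x xb : Eucl d} (hx : r x ≠ ⊤)
    (hb : IsProxPoint fs r ρ x xb) {D M : ℝ} (hD : 0 ≤ D) (hM : 0 ≤ M)
    (hlip : ∀ u ∈ Metric.closedBall xb D, ∀ v ∈ Metric.closedBall xb D,
      ‖gradient fs u - gradient fs v‖ ≤ M * ‖u - v‖) :
    AGLSModel (fun w => fs w + ρ / 2 * ‖w - x‖ ^ 2)
      (fun w => r w + (((2 * ρ - ρ) / 2 * ‖w - x‖ ^ 2 : ℝ) : EReal)) (2 * ρ - ρ) xb D (M + ρ) := by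
  have hρ := h.rho_pos
  have hμ : 2 * ρ - ρ = ρ := by ring
  rw [hμ]
  have htop : ∀ w, (r w + ((ρ / 2 * ‖w - x‖ ^ 2 : ℝ) : EReal) ≠ ⊤) ↔ r w ≠ ⊤ := fun w => by
    rw [add_comm, add_sq_ne_top_iff]
  have hset : {w | r w + ((ρ / 2 * ‖w - x‖ ^ 2 : ℝ) : EReal) ≠ ⊤} = {w | r w ≠ ⊤} := by
    ext w; exact htop w
  have hr := h.convex.convexOn_toReal h.ne_bot
  refine ⟨hρ, fun w => ?_, ?_, fun v z γ hγ => ?_, ?_, h.weaklyConvex.add_sq_sub x,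
    (htop xb).2 hb.ne_top, fun w hw => ?_, hD, by linarith, fun u hu v hv => ?_⟩
  · exact EReal.add_ne_bot_iff.2 ⟨h.ne_bot w, EReal.coe_ne_bot _⟩
  · rw [hset]
    refine ⟨hr.1, fun y hy w hw s t hs ht hst => ?_⟩
    have := (hr.strongConvexOn_add_sq (m := ρ) x).2 hy hw hs ht hst
    simp only [toReal_add_coe hy (h.ne_bot _), toReal_add_coe hw (h.ne_bot _),
      toReal_add_coe (hr.1 hy hw hs ht hst) (h.ne_bot _)]
    exact this
  · obtain ⟨b, hb⟩ := h.reg_bddBelow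
    -- Half of the coefficient `ρ/2` absorbs the linear term by Young's inequality; the other half
    -- gives the coercivity constant `ρ/4`.
    obtain ⟨u, -, hu⟩ := exists_argmin_coe_add (q := fun w => inner ℝ v w + γ / 2 * ‖w - z‖ ^ 2
      + ρ / 2 * ‖w - x‖ ^ 2) (c := ρ / 4) (b := inner ℝ v x - ‖v‖ ^ 2 / ρ) (p := x) (by fun_prop)
      h.lsc hb hx (by linarith) (fun w => by
        have e1 := (abs_le.1 (abs_real_inner_le_norm v (w - x))).1
        have e2 : 0 ≤ γ / 2 * ‖w - z‖ ^ 2 := by positivity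
        have e3 : ‖v‖ * ‖w - x‖ ≤ ρ / 4 * ‖w - x‖ ^ 2 + ‖v‖ ^ 2 / ρ := by
          have : ρ / 4 * ‖w - x‖ ^ 2 + ‖v‖ ^ 2 / ρ - ‖v‖ * ‖w - x‖
            = (ρ * ‖w - x‖ - 2 * ‖v‖) ^ 2 / (4 * ρ) := by field_simp; ring
          have : 0 ≤ (ρ * ‖w - x‖ - 2 * ‖v‖) ^ 2 / (4 * ρ) := by positivity
          linarith
        rw [inner_sub_right] at e1
        linarith)
    refine ⟨u, fun w => ?_⟩
    have := hu w
    rw [EReal.coe_add, EReal.coe_add _ (ρ / 2 * ‖w - x‖ ^ 2)] at this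
    rwa [add_comm (r u), add_comm (r w), ← add_assoc, ← add_assoc]
  · exact fun u => (hasGradientAt_add_sq h.differentiable x u).differentiableAt
  · have hw' := (htop w).1 hw
    have := hb.isMin w hw'
    simp only [toReal_add_coe hw' (h.ne_bot _), toReal_add_coe hb.ne_top (h.ne_bot _)]
    linarith
  · rw [(hasGradientAt_add_sq h.differentiable x u).gradient,
      (hasGradientAt_add_sq h.differentiable x v).gradient,
      show gradient fs u + ρ • (u - x) - (gradient fs v + ρ • (v - x))
        = (gradient fs u - gradient fs v) + ρ • (u - v) by module]
    refine (norm_add_le _ _).trans ?_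
    rw [norm_smul, Real.norm_of_nonneg hρ.le]
    linarith [hlip u hu v hv]

/-! ### Stationarity -/

/-- Proximal points of the original problem yield limiting subgradients. -/
lemma IsProxPoint.mem_limitingSubdiff {x xh : Eucl d} (h : IsProxPoint f r ρ x xh) (hρ : 0 < ρ)
    (hbot : ∀ x, r x ≠ ⊥) : -(2 * ρ) • (xh - x) ∈ limitingSubdiff (composite f r) xh := by
  have htop : composite f r xh ≠ ⊤ := add_sq_ne_top_iff.2 h.ne_top
  have hnb : composite f r xh ≠ ⊥ := EReal.add_ne_bot_iff.2 ⟨EReal.coe_ne_bot _, hbot _⟩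
  have hfre : -(2 * ρ) • (xh - x) ∈ frechetSubdiff (composite f r) xh := by
    refine ⟨htop, hnb, fun c hc => ?_⟩
    -- Within distance `c/ρ` the quadratic error `ρ‖y - xh‖²` is at most `c‖y - xh‖`.
    filter_upwards [Metric.ball_mem_nhds xh (div_pos hc hρ)] with y hy
    by_cases hy' : r y = ⊤
    · simp [composite, hy']
    have e : composite f r y = ((f y + (r y).toReal : ℝ) : EReal) := by
      rw [composite, EReal.coe_add, EReal.coe_toReal hy' (hbot y)]
    have e' : (composite f r xh).toReal = f xh + (r xh).toReal := by
      rw [composite, add_comm, toReal_add_coe h.ne_top (hbot _), add_comm]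
    rw [e, EReal.coe_le_coe_iff, e']
    have h1 := h.isMin y hy'
    have h2 : ρ * ‖y - xh‖ ^ 2 ≤ c * ‖y - xh‖ := by
      rw [mem_ball_iff_norm, lt_div_iff₀' hρ] at hy
      nlinarith [norm_nonneg (y - xh)]
    have h3 : ‖y - x‖ ^ 2 = ‖y - xh‖ ^ 2 + 2 * inner ℝ (xh - x) (y - xh) + ‖xh - x‖ ^ 2 := by
      rw [show y - x = (y - xh) + (xh - x) by abel, norm_add_sq_real, real_inner_comm]
    rw [h3] at h1
    rw [inner_smul_left]
    simp only [conj_trivial]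
    linarith
  exact ⟨htop, hnb, fun _ => xh, fun _ => _, tendsto_const_nhds, tendsto_const_nhds,
    fun _ => hfre, tendsto_const_nhds⟩

/-- An approximate proximal step on the smoothed problem with a small gap ends at an
approximately stationary point of the original problem. -/
lemma SmoothedProblem.isApproxStationary (h : SmoothedProblem fs r ρ) {x xb xp : Eucl d} {R ε : ℝ}
    (hf : Continuous f) (hle : ∀ w, fs w ≤ f w) (hε : 0 < ε) (hR : 0 ≤ R)
    (hb : IsProxPoint fs r ρ x xb) (hup : f xb ≤ fs xb + R * ε ^ 2) (hx : r x ≠ ⊤)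
    (hxp : r xp ≠ ⊤)
    (hgap : fs x + (r x).toReal - (fs xb + (r xb).toReal + ρ * ‖xb - x‖ ^ 2) ≤ ε ^ 2)
    (hhalf : fs xp + (r xp).toReal + ρ * ‖xp - x‖ ^ 2
        - (fs xb + (r xb).toReal + ρ * ‖xb - x‖ ^ 2)
      ≤ (fs x + (r x).toReal - (fs xb + (r xb).toReal + ρ * ‖xb - x‖ ^ 2)) / 2) :
    IsApproxStationary (composite f r) ((1 + 6 * ρ) * (√((R + 2) / ρ) + √(1 / ρ)) * ε)
      ((1 + 6 * ρ) * (√((R + 2) / ρ) + √(1 / ρ)) * ε) xp := by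
  have hρ := h.rho_pos
  obtain ⟨a, ha⟩ := h.bddBelow
  obtain ⟨b, hbr⟩ := h.reg_bddBelow
  -- The coefficient `3ρ` beats the `2ρ` lost in `‖xh - x‖² ≤ 2‖xh - xb‖² + 2‖xb - x‖²`. The
  -- subgradient is `-6ρ(xh - xb)`, whence the factor `1 + 6ρ`.
  obtain ⟨xh, hxh⟩ := exists_isProxPoint (ρ := 3 * ρ) hf (fun w => (ha w).trans (hle w)) h.lsc hbr
    (by linarith) hx xb
  have hsqrt : ∀ {s q : ℝ}, ρ * s ^ 2 ≤ q * ε ^ 2 → s ≤ √(q / ρ) * ε := fun {s q} hs => by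
    refine le_trans (Real.le_sqrt_of_sq_le (y := q / ρ * ε ^ 2) ?_) ?_
    · rw [div_mul_eq_mul_div, le_div_iff₀' hρ]; exact hs
    · rw [Real.sqrt_mul' _ (sq_nonneg ε), Real.sqrt_sq hε.le]
  -- Adding the minimality of `xh` for `φ` to that of `xb` for the smoothed subproblem gives
  -- `(3/2)ρ‖xh - xb‖² ≤ Rε² + ρ‖xb - x‖²`, and the gap bound gives `ρ‖xb - x‖² ≤ 2ε²`.
  have hs : ‖xh - xb‖ ≤ √((R + 2) / ρ) * ε := by
    apply hsqrt
    have e1 := hxh.isMin xb hb.ne_top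
    rw [sub_self, norm_zero] at e1
    have e2 := h.add_sq_le_of_isProxPoint hb hxh.ne_top
    have e3 := h.add_sq_le_of_isProxPoint hb hx
    have e4 : ‖xh - x‖ ^ 2 = ‖xh - xb‖ ^ 2 + 2 * inner ℝ (xh - xb) (xb - x) + ‖xb - x‖ ^ 2 := by
      rw [show xh - x = (xh - xb) + (xb - x) by abel, norm_add_sq_real]
    have e5 : ρ * (2 * inner ℝ (xh - xb) (xb - x)) ≤ ρ * (‖xh - xb‖ ^ 2 + ‖xb - x‖ ^ 2) := by
      refine mul_le_mul_of_nonneg_left ?_ hρ.le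
      have := real_inner_le_norm (xh - xb) (xb - x)
      nlinarith [sq_nonneg (‖xh - xb‖ - ‖xb - x‖)]
    rw [sub_self, norm_zero, norm_sub_rev x xb] at e3
    rw [e4] at e2
    have := hle xh
    have := mul_nonneg hρ.le (sq_nonneg ‖xh - xb‖)
    nlinarith only [e1, e2, e3, e5, hup, hgap, this, hle xh]
  have ht : ‖xp - xb‖ ≤ √(1 / ρ) * ε := by
    apply hsqrt
    have e2 := h.add_sq_le_of_isProxPoint hb hxp
    linarith
  have hs0 : 0 ≤ √((R + 2) / ρ) * ε := by positivity
  have ht0 : 0 ≤ √(1 / ρ) * ε := by positivity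
  refine ⟨xh, add_sq_ne_top_iff.2 hxh.ne_top, ?_, ?_⟩
  · calc ‖xh - xp‖ ≤ ‖xh - xb‖ + ‖xb - xp‖ := norm_sub_le_norm_sub_add_norm_sub _ _ _
      _ ≤ √((R + 2) / ρ) * ε + √(1 / ρ) * ε := by
        rw [norm_sub_rev xb xp]; exact add_le_add hs ht
      _ ≤ (1 + 6 * ρ) * (√((R + 2) / ρ) + √(1 / ρ)) * ε := by nlinarith
  · refine (Metric.infEDist_le_edist_of_mem
      (hxh.mem_limitingSubdiff (by linarith) (ne_bot_of_coe_le hbr))).trans ?_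
    rw [edist_dist, dist_zero_left, norm_smul]
    refine ENNReal.ofReal_le_ofReal ?_
    rw [norm_neg, Real.norm_of_nonneg (by linarith)]
    nlinarith

end

/-! ### Runs of AGLS-SIPP -/

/-- One outer step from `x` to `xp` with proximal point `xb` halves the gap of the subproblem. -/
structure IsHalvingStep {d : ℕ} (fs : Eucl d → ℝ) (r : Eucl d → EReal) (ρ : ℝ)
    (x xb xp : Eucl d) : Prop where
  prox : IsProxPoint fs r ρ x xb
  ne_top : r xp ≠ ⊤
  half : fs xp + (r xp).toReal + ρ * ‖xp - x‖ ^ 2 - (fs xb + (r xb).toReal + ρ * ‖xb - x‖ ^ 2)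
    ≤ (fs x + (r x).toReal - (fs xb + (r xb).toReal + ρ * ‖xb - x‖ ^ 2)) / 2

/-- Local Lipschitz data around the initial sublevel set. -/
structure LocalModulus {d : ℕ} (fs : Eucl d → ℝ) (r : Eucl d → EReal) (ρ : ℝ) (x0 : Eucl d)
    (l D M : ℝ) : Prop where
  start_ne_top : r x0 ≠ ⊤
  lower : ∀ w, r w ≠ ⊤ → l ≤ fs w + (r w).toReal
  radius_nonneg : 0 ≤ D
  radius : 8 / ρ * (fs x0 + (r x0).toReal - l) ≤ D ^ 2
  modulus_nonneg : 0 ≤ M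
  lip : ∀ s, r s ≠ ⊤ → fs s + (r s).toReal ≤ fs x0 + (r x0).toReal →
    ∀ u ∈ Metric.closedBall s D, ∀ v ∈ Metric.closedBall s D,
      ‖gradient fs u - gradient fs v‖ ≤ M * ‖u - v‖

section

variable {d : ℕ} {f fs : Eucl d → ℝ} {r : Eucl d → EReal} {ρ : ℝ} {x0 x xb xp : Eucl d}
  {l D M L0 τd τu Λ : ℝ}

lemma IsProxPoint.le_self (hb : IsProxPoint fs r ρ x xb) (hx : r x ≠ ⊤) :
    fs xb + (r xb).toReal + ρ * ‖xb - x‖ ^ 2 ≤ fs x + (r x).toReal := by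
  simpa using hb.isMin x hx

lemma IsHalvingStep.descent (h : IsHalvingStep fs r ρ x xb xp) (hρ : 0 < ρ) :
    (fs x + (r x).toReal - (fs xb + (r xb).toReal + ρ * ‖xb - x‖ ^ 2)) / 2
      ≤ fs x + (r x).toReal - (fs xp + (r xp).toReal) := by
  have := mul_nonneg hρ.le (sq_nonneg ‖xp - x‖)
  linarith [h.half]

lemma IsHalvingStep.le (h : IsHalvingStep fs r ρ x xb xp) (hρ : 0 < ρ) (hx : r x ≠ ⊤) :
    fs xp + (r xp).toReal ≤ fs x + (r x).toReal := by
  linarith [h.descent hρ, h.prox.le_self hx]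

/-- The proximal point has a value no larger than `x`, so it lies in `S₀`, and the Lipschitz data
around it are available. -/
lemma SmoothedProblem.localModel (h : SmoothedProblem fs r ρ) (hl : LocalModulus fs r ρ x0 l D M)
    (hx : r x ≠ ⊤) (hxl : fs x + (r x).toReal ≤ fs x0 + (r x0).toReal)
    (hb : IsProxPoint fs r ρ x xb) :
    AGLSModel (fun w => fs w + ρ / 2 * ‖w - x‖ ^ 2)
      (fun w => r w + (((2 * ρ - ρ) / 2 * ‖w - x‖ ^ 2 : ℝ) : EReal)) (2 * ρ - ρ) xb D (M + ρ) := by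
  refine h.aglsModel hx hb hl.radius_nonneg hl.modulus_nonneg (hl.lip xb hb.ne_top ?_)
  have := hb.le_self hx
  have := mul_nonneg h.rho_pos.le (sq_nonneg ‖xb - x‖)
  linarith

lemma SmoothedProblem.local_radius (h : SmoothedProblem fs r ρ)
    (hl : LocalModulus fs r ρ x0 l D M) (hx : r x ≠ ⊤)
    (hxl : fs x + (r x).toReal ≤ fs x0 + (r x0).toReal) (hb : IsProxPoint fs r ρ x xb) :
    8 / (2 * ρ - ρ) * (fs x + ρ / 2 * ‖x - x‖ ^ 2
      + (r x + (((2 * ρ - ρ) / 2 * ‖x - x‖ ^ 2 : ℝ) : EReal)).toReal - (fs xb + ρ / 2 * ‖xb - x‖ ^ 2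
      + (r xb + (((2 * ρ - ρ) / 2 * ‖xb - x‖ ^ 2 : ℝ) : EReal)).toReal)) ≤ D ^ 2 := by
  have hρ := h.rho_pos
  rw [toReal_add_coe hx (h.ne_bot _), toReal_add_coe hb.ne_top (h.ne_bot _), sub_self, norm_zero,
    show 2 * ρ - ρ = ρ by ring]
  refine le_trans (mul_le_mul_of_nonneg_left ?_ (by positivity)) hl.radius
  have := hl.lower xb hb.ne_top
  have := mul_nonneg hρ.le (sq_nonneg ‖xb - x‖)
  linarith

lemma SmoothedProblem.exists_aglsRun (h : SmoothedProblem fs r ρ)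
    (hl : LocalModulus fs r ρ x0 l D M) (hL0 : 0 < L0) (hτd : 0 < τd) (hτd1 : τd < 1)
    (hτu : 1 < τu) (hx : r x ≠ ⊤) (hxl : fs x + (r x).toReal ≤ fs x0 + (r x0).toReal) :
    ∃ s T, IsAGLSRun (fun w => fs w + ρ / 2 * ‖w - x‖ ^ 2)
      (fun w => r w + (((2 * ρ - ρ) / 2 * ‖w - x‖ ^ 2 : ℝ) : EReal)) (2 * ρ - ρ) L0 τd τu x s T := by
  obtain ⟨xb, hb⟩ := h.exists_prox hx
  refine (h.localModel hl hx hxl hb).exists_run ?_ hL0 hτd hτd1 hτu (h.local_radius hl hx hxl hb)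
  rw [add_comm]
  exact add_sq_ne_top_iff.2 hx

lemma SmoothedProblem.aglsRun_bound (h : SmoothedProblem fs r ρ)
    (hl : LocalModulus fs r ρ x0 l D M) (hL0 : 0 < L0) (hτd : 0 < τd) (hτd1 : τd < 1)
    (hτu : 1 < τu) (hΛ0 : L0 ≤ Λ) (hΛ : 3 * (M + ρ) * τu ≤ Λ) (hx : r x ≠ ⊤)
    (hxl : fs x + (r x).toReal ≤ fs x0 + (r x0).toReal) {s : ℕ → AGLSState d} {T : ℕ}
    (hrun : IsAGLSRun (fun w => fs w + ρ / 2 * ‖w - x‖ ^ 2)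
      (fun w => r w + (((2 * ρ - ρ) / 2 * ‖w - x‖ ^ 2 : ℝ) : EReal)) (2 * ρ - ρ) L0 τd τu x s T) :
    (T : ℝ) ≤ 1 + 2 * √((Λ + ρ) / ρ) ∧ ∃ xb, IsHalvingStep fs r ρ x xb (s T).y := by
  obtain ⟨xb, hb⟩ := h.exists_prox hx
  have hx' : r x + (((2 * ρ - ρ) / 2 * ‖x - x‖ ^ 2 : ℝ) : EReal) ≠ ⊤ := by
    rw [add_comm]; exact add_sq_ne_top_iff.2 hx
  obtain ⟨h1, h2, h3⟩ := (h.localModel hl hx hxl hb).run_bound hx' hL0 hτd hτd1 hτu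
    (h.local_radius hl hx hxl hb) hΛ0 hΛ hrun
  have hy : r (s T).y ≠ ⊤ := by
    rwa [add_comm, add_sq_ne_top_iff] at h1
  rw [toReal_add_coe hx (h.ne_bot _), toReal_add_coe hb.ne_top (h.ne_bot _),
    toReal_add_coe hy (h.ne_bot _), sub_self, norm_zero] at h3
  refine ⟨by rwa [show 2 * ρ - ρ = ρ by ring] at h2, xb, hb, hy, ?_⟩
  linarith

lemma SmoothedProblem.exists_sippRun (h : SmoothedProblem fs r ρ)
    (hl : LocalModulus fs r ρ x0 l D M) (hL0 : 0 < L0) (hτd : 0 < τd) (hτd1 : τd < 1)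
    (hτu : 1 < τu) : ∃ xs T, IsAGLSSIPPRun fs r ρ (2 * ρ) L0 τd τu x0 xs T := by
  classical
  let Run : Eucl d → (ℕ → AGLSState d) × ℕ → Prop := fun x p =>
    IsAGLSRun (fun w => fs w + ρ / 2 * ‖w - x‖ ^ 2)
      (fun w => r w + (((2 * ρ - ρ) / 2 * ‖w - x‖ ^ 2 : ℝ) : EReal)) (2 * ρ - ρ) L0 τd τu x p.1 p.2
  let out : Eucl d → (ℕ → AGLSState d) × ℕ := fun x =>
    if h : ∃ p, Run x p then h.choose else (fun _ => AGLSState.init x L0, 0)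
  let nxt : Eucl d → Eucl d := fun x => ((out x).1 (out x).2).y
  let xs : ℕ → Eucl d := fun n => nxt^[n] x0
  have hxs : ∀ n, xs (n + 1) = nxt (xs n) := fun n => Function.iterate_succ_apply' nxt n x0
  have hrun : ∀ x, r x ≠ ⊤ → fs x + (r x).toReal ≤ fs x0 + (r x0).toReal → Run x (out x) := by
    intro x hx hxl
    obtain ⟨s, T, hsT⟩ := h.exists_aglsRun hl hL0 hτd hτd1 hτu hx hxl
    have hex : ∃ p, Run x p := ⟨(s, T), hsT⟩
    have e : out x = hex.choose := dif_pos hex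
    rw [e]
    exact hex.choose_spec
  have hinv : ∀ n, r (xs n) ≠ ⊤ ∧ fs (xs n) + (r (xs n)).toReal ≤ fs x0 + (r x0).toReal := by
    intro n
    induction n with
    | zero => exact ⟨hl.start_ne_top, le_rfl⟩
    | succ n ih =>
      obtain ⟨-, xb, hh⟩ := h.aglsRun_bound hl hL0 hτd hτd1 hτu (le_max_left L0 _)
        (le_max_right _ _) ih.1 ih.2 (hrun _ ih.1 ih.2)
      rw [hxs]
      exact ⟨hh.ne_top, (hh.le h.rho_pos ih.1).trans ih.2⟩
  -- The count at index `k + 1` belongs to the subproblem centered at `xs k`; the value at index `0`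
  -- is irrelevant.
  refine ⟨xs, fun n => (out (xs (n - 1))).2, rfl, fun k => ⟨(out (xs k)).1, ?_, ?_⟩⟩
  · exact hrun _ (hinv k).1 (hinv k).2
  · exact hxs k

/-- The run is arbitrary and unrelated to `l`, `D`, `M`, so the same run can be measured against
several choices of local data. -/
lemma SmoothedProblem.sippRun_step (h : SmoothedProblem fs r ρ)
    (hl : LocalModulus fs r ρ x0 l D M) (hL0 : 0 < L0) (hτd : 0 < τd) (hτd1 : τd < 1)
    (hτu : 1 < τu) (hΛ0 : L0 ≤ Λ) (hΛ : 3 * (M + ρ) * τu ≤ Λ) {xs : ℕ → Eucl d} {T : ℕ → ℕ}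
    (hrun : IsAGLSSIPPRun fs r ρ (2 * ρ) L0 τd τu x0 xs T) (k : ℕ) :
    r (xs k) ≠ ⊤ ∧ fs (xs k) + (r (xs k)).toReal ≤ fs x0 + (r x0).toReal ∧
      (T (k + 1) : ℝ) ≤ 1 + 2 * √((Λ + ρ) / ρ) ∧
      ∃ xb, IsHalvingStep fs r ρ (xs k) xb (xs (k + 1)) := by
  have hinv : r (xs k) ≠ ⊤ ∧ fs (xs k) + (r (xs k)).toReal ≤ fs x0 + (r x0).toReal := by
    induction k with
    | zero => rw [hrun.start]; exact ⟨hl.start_ne_top, le_rfl⟩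
    | succ n ih =>
      obtain ⟨s, hs, hy⟩ := hrun.next n
      obtain ⟨-, xb, hh⟩ := h.aglsRun_bound hl hL0 hτd hτd1 hτu hΛ0 hΛ ih.1 ih.2 hs
      rw [hy]
      exact ⟨hh.ne_top, (hh.le h.rho_pos ih.1).trans ih.2⟩
  obtain ⟨s, hs, hy⟩ := hrun.next k
  rw [hy]
  exact ⟨hinv.1, hinv.2, h.aglsRun_bound hl hL0 hτd hτd1 hτu hΛ0 hΛ hinv.1 hinv.2 hs⟩

/-- Among the first `n` halving steps, some step has a gap at most `e`. -/
lemma exists_small_gap (hρ : 0 < ρ) {xs xb : ℕ → Eucl d}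
    (hstep : ∀ k, IsHalvingStep fs r ρ (xs k) (xb k) (xs (k + 1)))
    (hlow : ∀ w, r w ≠ ⊤ → l ≤ fs w + (r w).toReal) {e : ℝ} {n : ℕ}
    (hn : 2 * (fs (xs 0) + (r (xs 0)).toReal - l) < n * e) :
    ∃ k < n, fs (xs k) + (r (xs k)).toReal
      - (fs (xb k) + (r (xb k)).toReal + ρ * ‖xb k - xs k‖ ^ 2) ≤ e := by
  by_contra! hcon
  -- If every gap exceeded `e`, each step would lower the objective by `e/2`, and after `n` steps it
  -- would be below `l`.
  have hind : ∀ j ≤ n, fs (xs j) + (r (xs j)).toReal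
      ≤ fs (xs 0) + (r (xs 0)).toReal - j * e / 2 := by
    intro j
    induction j with
    | zero => simp
    | succ j ih =>
      intro hj
      have h1 := ih (by omega)
      have h2 := (hstep j).descent hρ
      have h3 := hcon j (by omega)
      push_cast
      linarith
  rcases n with _ | n
  · have hx := hlow _ (hstep 0).prox.ne_top
    have h0 := (hstep 0).descent hρ
    have h1 := hlow _ (hstep 0).ne_top
    have h2 := (hstep 0).half
    have h3 := (hstep 0).prox.isMin _ (hstep 0).ne_top
    simp only [Nat.cast_zero, zero_mul] at hn
    have h4 := mul_nonneg hρ.le (sq_nonneg ‖xb 0 - xs 0‖)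
    have h5 := mul_nonneg hρ.le (sq_nonneg ‖xs (0 + 1) - xs 0‖)
    linarith
  · have h1 := hind (n + 1) le_rfl
    have h2 := hlow _ (hstep n).ne_top
    linarith

end

/-! ### Conversion between extended-real and real inequalities -/

section

variable {d : ℕ} {f fs : Eucl d → ℝ} {r : Eucl d → EReal} {x0 : Eucl d}

lemma composite_eq_coe (hbot : ∀ x, r x ≠ ⊥) {x : Eucl d} (hx : r x ≠ ⊤) :
    composite f r x = ((f x + (r x).toReal : ℝ) : EReal) := by
  rw [composite, EReal.coe_add, EReal.coe_toReal hx (hbot x)]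

lemma mem_initialLevel_iff (hbot : ∀ x, r x ≠ ⊥) (hx0 : r x0 ≠ ⊤) {x : Eucl d} :
    x ∈ initialLevel (composite f r) x0 ↔
      r x ≠ ⊤ ∧ f x + (r x).toReal ≤ f x0 + (r x0).toReal := by
  rw [initialLevel, mem_ofPred_eq, composite_eq_coe hbot hx0]
  by_cases hx : r x = ⊤
  · simp only [composite, hx, EReal.coe_add_top, ne_eq, not_true, false_and, iff_false, top_le_iff]
    exact EReal.coe_ne_top _
  · rw [composite_eq_coe hbot hx, EReal.coe_le_coe_iff]
    simp [hx]

lemma le_of_coe_le_composite (hbot : ∀ x, r x ≠ ⊥) {l : ℝ} (hl : ∀ x, (l : EReal) ≤ composite f r x)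
    (w : Eucl d) (hw : r w ≠ ⊤) : l ≤ f w + (r w).toReal := by
  have := hl w
  rwa [composite_eq_coe hbot hw, EReal.coe_le_coe_iff] at this

end

/-! ### Complexity -/

/-- The constant that multiplies `√B + √L/ε + 1` in the bound on the inner iterations. -/
noncomputable def innerConst (ρ τu L0 : ℝ) : ℝ := 1 + 2 * √(1 + (L0 + 3 * τu * ρ + 3 * τu) / ρ)

lemma innerConst_pos (ρ τu L0 : ℝ) : 0 < innerConst ρ τu L0 := by
  unfold innerConst; positivity

/-- The radicand is affine in `b + l/ε²`, and `b + l/ε² + 1` is at most the square of `√b + √l/ε +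
1`. -/
lemma inner_iterations_le {ρ τu L0 b l ε : ℝ} (hρ : 0 < ρ) (hτu : 0 < τu) (hL0 : 0 < L0)
    (hb : 0 ≤ b) (hl : 0 ≤ l) (hε : 0 < ε) :
    1 + 2 * √((L0 + 3 * (b + l / ε ^ 2 + ρ) * τu + ρ) / ρ)
      ≤ innerConst ρ τu L0 * (√b + √l / ε + 1) := by
  set a := √(1 + (L0 + 3 * τu * ρ + 3 * τu) / ρ) with ha
  set W := √b + √l / ε + 1 with hW
  have hW1 : 1 ≤ W := by
    have : 0 ≤ √b + √l / ε := by positivity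
    linarith
  have hW2 : b + l / ε ^ 2 + 1 ≤ W ^ 2 := by
    have e1 : √b ^ 2 = b := Real.sq_sqrt hb
    have e2 : (√l / ε) ^ 2 = l / ε ^ 2 := by rw [div_pow, Real.sq_sqrt hl]
    have h1 : 0 ≤ √b * (√l / ε) := by positivity
    have h2 : 0 ≤ √b := by positivity
    have h3 : 0 ≤ √l / ε := by positivity
    rw [hW]
    nlinarith
  have hasq : a ^ 2 = 1 + (L0 + 3 * τu * ρ + 3 * τu) / ρ := Real.sq_sqrt (by positivity)
  have hkey : √((L0 + 3 * (b + l / ε ^ 2 + ρ) * τu + ρ) / ρ) ≤ a * W := by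
    refine Real.sqrt_le_iff.2 ⟨by positivity, ?_⟩
    rw [mul_pow]
    refine le_trans ?_ (mul_le_mul_of_nonneg_left hW2 (sq_nonneg a))
    rw [hasq, div_le_iff₀ hρ]
    have e : (1 + (L0 + 3 * τu * ρ + 3 * τu) / ρ) * (b + l / ε ^ 2 + 1) * ρ
      = (ρ + (L0 + 3 * τu * ρ + 3 * τu)) * (b + l / ε ^ 2 + 1) := by field_simp
    rw [e]
    have h1 : 0 ≤ l / ε ^ 2 := by positivity
    have h2 : 0 ≤ (ρ + L0 + 3 * τu * ρ) * (b + l / ε ^ 2) := by positivity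
    nlinarith
  unfold innerConst
  nlinarith

/-! ### The complexity bound for smooth approximations -/

lemma pairSup_nonneg {d : ℕ} {F : Eucl d → Eucl d → ℝ} (hF : ∀ x y, 0 ≤ F x y)
    (P : Set (Eucl d × Eucl d)) : 0 ≤ pairSup F P :=
  Real.sSup_nonneg (by rintro _ ⟨p, -, rfl⟩; exact hF _ _)

lemma PairBounded.le_pairSup {d : ℕ} {F : Eucl d → Eucl d → ℝ} {P : Set (Eucl d × Eucl d)}
    (h : PairBounded F P) {p : Eucl d × Eucl d} (hp : p ∈ P) : F p.1 p.2 ≤ pairSup F P :=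
  le_csSup h ⟨p, hp, rfl⟩

lemma pairBounded_of_le {d : ℕ} {F : Eucl d → Eucl d → ℝ} {P : Set (Eucl d × Eucl d)} {c : ℝ}
    (h : ∀ p ∈ P, F p.1 p.2 ≤ c) : PairBounded F P :=
  ⟨c, by rintro _ ⟨p, hp, rfl⟩; exact h p hp⟩

lemma commonBallPairs_subset_tubePairs {d : ℕ} (S : Set (Eucl d)) (D : ℝ) :
    commonBallPairs S D ⊆ tubePairs S D := by
  rintro p ⟨s, hs, h1, h2⟩
  exact ⟨(Metric.infDist_le_dist_of_mem hs).trans h1, (Metric.infDist_le_dist_of_mem hs).trans h2⟩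

lemma exists_norm_le_of_mem_tubePairs {d : ℕ} {S : Set (Eucl d)} (hS : Bornology.IsBounded S)
    (hne : S.Nonempty) (D : ℝ) : ∃ ϱ, ∀ p ∈ tubePairs S D, ‖p.1‖ ≤ ϱ ∧ ‖p.2‖ ≤ ϱ := by
  obtain ⟨c, hc⟩ := hS.exists_norm_le
  have key : ∀ x, Metric.infDist x S ≤ D → ‖x‖ ≤ c + (D + 1) := by
    intro x hx
    obtain ⟨s, hs, hxs⟩ := (Metric.infDist_lt_iff hne).1 (lt_of_le_of_lt hx (lt_add_one D))
    rw [dist_eq_norm] at hxs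
    calc ‖x‖ = ‖s + (x - s)‖ := by rw [add_sub_cancel]
      _ ≤ ‖s‖ + ‖x - s‖ := norm_add_le _ _
      _ ≤ c + (D + 1) := add_le_add (hc s hs) hxs.le
  exact ⟨c + (D + 1), fun p hp => ⟨key _ hp.1, key _ hp.2⟩⟩

section

variable {d : ℕ} {f fs : Eucl d → ℝ} {r : Eucl d → EReal} {ρ η D l b e : ℝ}
  {Rs : Eucl d → ℝ} {B L : Eucl d → Eucl d → ℝ} {x0 : Eucl d}

lemma IsSmoothApprox.smoothedProblem
    (hs : IsSmoothApprox f fs ρ Rs (fun x y => B x y + L x y / η)) (hρ : 0 < ρ)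
    (hconv : IsConvexExt r) (hlsc : LowerSemicontinuous r) (hr : ∃ a : ℝ, ∀ x, (a : EReal) ≤ r x)
    (hlow : ∃ a : ℝ, ∀ x, a ≤ fs x) : SmoothedProblem fs r ρ :=
  ⟨hρ, hs.contDiff.differentiable one_ne_zero, hs.weaklyConvex, hlow, hconv, hlsc, hr⟩

lemma IsSmoothApprox.localModulus
    (hs : IsSmoothApprox f fs ρ Rs (fun x y => B x y + L x y / η)) (hη : 0 < η)
    (hbot : ∀ x, r x ≠ ⊥) (hx0 : r x0 ≠ ⊤) (hl : ∀ w, r w ≠ ⊤ → l ≤ fs w + (r w).toReal)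
    (hD : 0 ≤ D) (hD2 : 8 / ρ * (fs x0 + (r x0).toReal - l) ≤ D ^ 2) (hb : 0 ≤ b) (he : 0 ≤ e)
    (hBL : ∀ p ∈ commonBallPairs (initialLevel (composite fs r) x0) D,
      B p.1 p.2 ≤ b ∧ L p.1 p.2 ≤ e) :
    LocalModulus fs r ρ x0 l D (b + e / η) := by
  refine ⟨hx0, hl, hD, hD2, by positivity, fun s hs1 hs2 u hu v hv => ?_⟩
  refine (hs.smooth u v).trans (mul_le_mul_of_nonneg_right ?_ (norm_nonneg _))
  obtain ⟨h1, h2⟩ := hBL (u, v) ⟨s, (mem_initialLevel_iff hbot hx0).2 ⟨hs1, hs2⟩, hu, hv⟩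
  exact add_le_add h1 (div_le_div_of_nonneg_right h2 hη.le)

end

/-- Complexity of AGLS-SIPP for a family of smooth approximations whose moduli are locally
bounded near the initial sublevel sets. -/
theorem complexity_of_isSmoothApprox {ρ R θ Δ τu L0 : ℝ} (hρ : 0 < ρ) (hR : 0 ≤ R) (hθ : 0 < θ)
    (hΔ : 0 ≤ Δ) (hτu : 1 < τu) (hL0 : 0 < L0) {d : ℕ} {f : Eucl d → ℝ} {r : Eucl d → EReal}
    {fη Rη : ℝ → Eucl d → ℝ} {B L : Eucl d → Eucl d → ℝ} {x0 : Eucl d} {τd : ℝ}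
    (hτd : 0 < τd) (hτd1 : τd < 1) (hf : Continuous f)
    (hconv : IsConvexExt r) (hlsc : LowerSemicontinuous r) (hr : ∃ a : ℝ, ∀ x, (a : EReal) ≤ r x)
    (hx0 : r x0 ≠ ⊤) (hgap : ∀ x, composite f r x0 ≤ composite f r x + (Δ : EReal))
    (hlow : ∀ η ∈ Ioc 0 θ, ∃ a : ℝ, ∀ x, a ≤ fη η x)
    (herr : ∀ η ∈ Ioc 0 θ, ∀ x ∈ initialLevel (composite (fη η) r) x0, Rη η x ≤ R * η)
    (hsm : ∀ η ∈ Ioc 0 θ,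
      IsSmoothApprox f (fη η) ρ (Rη η) (fun x y => B x y + L x y / η))
    (hB : ∀ x y, 0 ≤ B x y) (hL : ∀ x y, 0 ≤ L x y)
    (hball : ∀ D : ℝ, ∃ b e : ℝ, ∀ η ∈ Ioc 0 θ,
      ∀ p ∈ commonBallPairs (initialLevel (composite (fη η) r) x0) D, B p.1 p.2 ≤ b ∧ L p.1 p.2 ≤ e)
    (hbdd : ∀ ϱ : ℝ, ∃ b e : ℝ, ∀ x y : Eucl d, ‖x‖ ≤ ϱ → ‖y‖ ≤ ϱ → B x y ≤ b ∧ L x y ≤ e) :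
    ∃ C' > (0 : ℝ), ∀ ε : ℝ, 0 < ε → ε ^ 2 ≤ θ →
      (∃ xs T, IsAGLSSIPPRun (fη (ε ^ 2)) r ρ (2 * ρ) L0 τd τu x0 xs T) ∧
      ∀ xs T, IsAGLSSIPPRun (fη (ε ^ 2)) r ρ (2 * ρ) L0 τd τu x0 xs T →
        ∃ K ≥ 1, IsApproxStationary (composite f r)
            ((1 + 6 * ρ) * (√((R + 2) / ρ) + √(1 / ρ)) * ε)
            ((1 + 6 * ρ) * (√((R + 2) / ρ) + √(1 / ρ)) * ε) (xs K) ∧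
          ((∑ k ∈ Finset.Icc 1 K, T k : ℕ) : ℝ) ≤ C' / ε ^ 3 ∧
          ∀ l : ℝ, (∀ x, (l : EReal) ≤ composite (fη (ε ^ 2)) r x) →
          ∀ S0 : Set (Eucl d), S0 = initialLevel (composite (fη (ε ^ 2)) r) x0 →
          ∀ D : ℝ, D = √(8 / (2 * ρ - ρ) * (f x0 + (r x0).toReal - l)) →
          ∀ P : Set (Eucl d × Eucl d),
            (P = commonBallPairs S0 D ∨
              (LevelBounded (composite (fη (ε ^ 2)) r) ∧ P = tubePairs S0 D)) →
            PairBounded (fun x y => 2 * (B x y + L x y / ε ^ 2) + 2 * ρ) P ∧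
            PairBounded B P ∧ PairBounded L P ∧
            ((∑ k ∈ Finset.Icc 1 K, T k : ℕ) : ℝ) ≤
              (2 * (Δ + R * θ) + θ) * innerConst ρ τu L0 *
                (1 / ε ^ 2 * (√(pairSup B P) + √(pairSup L P) / ε + 1)) := by
  obtain ⟨a, ha⟩ := hr
  have hbot := ne_bot_of_coe_le ha
  -- `Q` bounds the initial gap of the smoothed objective for all admissible `η`: on `S₀` the error
  -- is at most `Rθ`, and off `S₀` values exceed the initial one. Hence the radius `D0` does not
  -- depend on `ε`, and neither does `C'`.
  set Q := Δ + R * θ with hQ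
  have hQ0 : 0 ≤ Q := by positivity
  set C := (2 * Q + θ) * innerConst ρ τu L0 with hC
  have hC0 : 0 < C := mul_pos (by linarith) (innerConst_pos _ _ _)
  set D0 := √(8 / ρ * Q) with hD0
  have hD0sq : D0 ^ 2 = 8 / ρ * Q := Real.sq_sqrt (by positivity)
  obtain ⟨b0, e0, hbe0⟩ := hball D0
  refine ⟨C * (√θ * √(max b0 0) + √(max e0 0) + √θ), by positivity, fun ε hε hεθ => ?_⟩
  have hη : ε ^ 2 ∈ Ioc 0 θ := ⟨by positivity, hεθ⟩
  have hs := hsm _ hη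
  have hp : SmoothedProblem (fη (ε ^ 2)) r ρ :=
    hs.smoothedProblem hρ hconv hlsc ⟨a, ha⟩ (hlow _ hη)
  set fs := fη (ε ^ 2) with hfs
  -- A lower bound of the smoothed objective.
  have hlowQ : ∀ w, r w ≠ ⊤ → fs x0 + (r x0).toReal - Q ≤ fs w + (r w).toReal := by
    intro w hw
    by_cases hwl : fs w + (r w).toReal ≤ fs x0 + (r x0).toReal
    · have h1 := herr _ hη w ((mem_initialLevel_iff hbot hx0).2 ⟨hw, hwl⟩)
      have h2 := hs.upper w
      have h3 := hgap w
      rw [composite_eq_coe hbot hw, composite_eq_coe hbot hx0, ← EReal.coe_add,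
        EReal.coe_le_coe_iff] at h3
      have h4 := hs.lower x0
      have h5 := mul_le_mul_of_nonneg_left hεθ hR
      linarith
    · linarith
  have hloc : ∀ {l D b e : ℝ}, (∀ w, r w ≠ ⊤ → l ≤ fs w + (r w).toReal) → 0 ≤ D →
      8 / ρ * (fs x0 + (r x0).toReal - l) ≤ D ^ 2 → 0 ≤ b → 0 ≤ e →
      (∀ p ∈ commonBallPairs (initialLevel (composite fs r) x0) D, B p.1 p.2 ≤ b ∧ L p.1 p.2 ≤ e) →
      LocalModulus fs r ρ x0 l D (b + e / ε ^ 2) := fun h1 h2 h3 h4 h5 h6 =>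
    hs.localModulus hη.1 hbot hx0 h1 h2 h3 h4 h5 h6
  have hloc0 : LocalModulus fs r ρ x0 (fs x0 + (r x0).toReal - Q) D0
      (max b0 0 + max e0 0 / ε ^ 2) := by
    refine hloc hlowQ (Real.sqrt_nonneg _) (by rw [hD0sq, sub_sub_cancel]) (le_max_right _ _)
      (le_max_right _ _) fun p hp => ?_
    obtain ⟨h1, h2⟩ := hbe0 _ hη p hp
    exact ⟨h1.trans (le_max_left _ _), h2.trans (le_max_left _ _)⟩
  refine ⟨hp.exists_sippRun hloc0 hL0 hτd hτd1 hτu, fun xs T hrun => ?_⟩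
  -- Choice of the outer iteration.
  have hstep0 := hp.sippRun_step hloc0 hL0 hτd hτd1 hτu (le_max_left L0 _) (le_max_right _ _) hrun
  choose hdom hlev _ xb hxb using hstep0
  obtain ⟨k, hk, hkgap⟩ := exists_small_gap (e := ε ^ 2) (n := ⌊2 * Q / ε ^ 2⌋₊ + 1) hρ hxb hlowQ (by
    rw [hrun.start, sub_sub_cancel, ← div_lt_iff₀ hη.1]
    push_cast
    exact Nat.lt_floor_add_one _)
  have hK : ((k + 1 : ℕ) : ℝ) ≤ (2 * Q + θ) / ε ^ 2 := by
    have h1 : ((k + 1 : ℕ) : ℝ) ≤ (⌊2 * Q / ε ^ 2⌋₊ : ℝ) + 1 := by exact_mod_cast hk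
    have h2 : (⌊2 * Q / ε ^ 2⌋₊ : ℝ) ≤ 2 * Q / ε ^ 2 := Nat.floor_le (by positivity)
    -- The extra step from rounding is paid for by `θ/ε²`, whence the summand `θ` in `C`.
    have h3 : 1 ≤ θ / ε ^ 2 := by rw [one_le_div hη.1]; exact hεθ
    rw [add_div]
    linarith
  -- The number of iterations in terms of bounds on the moduli.
  have hcount : ∀ {l D b e : ℝ}, 0 ≤ b → 0 ≤ e → LocalModulus fs r ρ x0 l D (b + e / ε ^ 2) →
      ((∑ j ∈ Finset.Icc 1 (k + 1), T j : ℕ) : ℝ) ≤ C * (1 / ε ^ 2 * (√b + √e / ε + 1)) := by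
    intro l D b e hb he hl
    have hpos : 0 ≤ 3 * (b + e / ε ^ 2 + ρ) * τu := by positivity
    have hT : ∀ j ∈ Finset.Icc 1 (k + 1), (T j : ℝ) ≤ innerConst ρ τu L0 * (√b + √e / ε + 1) := by
      intro j hj
      obtain ⟨i, rfl⟩ : ∃ i, j = i + 1 := ⟨j - 1, by have := (Finset.mem_Icc.1 hj).1; omega⟩
      exact (hp.sippRun_step hl hL0 hτd hτd1 hτu (by linarith)
        (by linarith : _ ≤ L0 + 3 * (b + e / ε ^ 2 + ρ) * τu) hrun i).2.2.1.trans
        (inner_iterations_le hρ (by linarith) hL0 hb he hε)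
    rw [Nat.cast_sum]
    refine (Finset.sum_le_card_nsmul _ _ _ hT).trans ?_
    rw [Nat.card_Icc, Nat.add_sub_cancel, nsmul_eq_mul]
    have hW : 0 ≤ innerConst ρ τu L0 * (√b + √e / ε + 1) :=
      mul_nonneg (innerConst_pos _ _ _).le (by positivity)
    refine (mul_le_mul_of_nonneg_right hK hW).trans (le_of_eq ?_)
    rw [hC]
    ring
  have hmem : xb k ∈ initialLevel (composite fs r) x0 := by
    refine (mem_initialLevel_iff hbot hx0).2 ⟨(hxb k).prox.ne_top, ?_⟩
    have h1 := (hxb k).prox.le_self (hdom k)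
    have h2 := mul_nonneg hρ.le (sq_nonneg ‖xb k - xs k‖)
    linarith [hlev k]
  refine ⟨k + 1, by omega, ?_, ?_, ?_⟩
  · refine hp.isApproxStationary hf hs.lower hε hR (hxb k).prox ?_ (hdom k) (hxb k).ne_top hkgap
      (hxb k).half
    linarith [hs.upper (xb k), herr _ hη _ hmem]
  · refine (hcount (le_max_right b0 0) (le_max_right e0 0) hloc0).trans ?_
    have hεs : ε ≤ √θ := Real.le_sqrt_of_sq_le hεθ
    rw [mul_div_assoc]
    refine mul_le_mul_of_nonneg_left ?_ hC0.le
    rw [le_div_iff₀ (by positivity)]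
    have e1 : 1 / ε ^ 2 * (√(max b0 0) + √(max e0 0) / ε + 1) * ε ^ 3
      = ε * √(max b0 0) + √(max e0 0) + ε := by field_simp
    rw [e1]
    have := mul_le_mul_of_nonneg_right hεs (Real.sqrt_nonneg (max b0 0))
    linarith
  -- The index `k` was fixed through `Q` alone, so `K` and the count stay the same for all `l` and
  -- `P`; only the local data passed to `hcount` change.
  · rintro l hl S0 rfl D hD P hP
    have hl' := le_of_coe_le_composite hbot hl
    have hDnn : 0 ≤ D := hD ▸ Real.sqrt_nonneg _
    have hDsq : 8 / ρ * (fs x0 + (r x0).toReal - l) ≤ D ^ 2 := by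
      have h1 := hl' x0 hx0
      have h2 := hs.lower x0
      have h3 : 0 ≤ f x0 + (r x0).toReal - l := by linarith
      have h4 : 0 ≤ 8 / ρ := by positivity
      rw [hD, show 2 * ρ - ρ = ρ by ring, Real.sq_sqrt (mul_nonneg h4 h3)]
      exact mul_le_mul_of_nonneg_left (by linarith) h4
    have hsub : commonBallPairs (initialLevel (composite fs r) x0) D ⊆ P := by
      rcases hP with rfl | ⟨-, rfl⟩
      · exact le_rfl
      · exact commonBallPairs_subset_tubePairs _ _
    obtain ⟨b, e, hbe⟩ : ∃ b e : ℝ, ∀ p ∈ P, B p.1 p.2 ≤ b ∧ L p.1 p.2 ≤ e := by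
      rcases hP with rfl | ⟨hlb, rfl⟩
      · obtain ⟨b, e, hbe⟩ := hball D
        exact ⟨b, e, hbe _ hη⟩
      · have hS : Bornology.IsBounded (initialLevel (composite fs r) x0) := by
          have := hlb (fs x0 + (r x0).toReal)
          rwa [← composite_eq_coe hbot hx0] at this
        obtain ⟨ϱ, hϱ⟩ := exists_norm_le_of_mem_tubePairs hS
          ⟨x0, (mem_initialLevel_iff hbot hx0).2 ⟨hx0, le_rfl⟩⟩ D
        obtain ⟨b, e, hbe⟩ := hbdd ϱ
        exact ⟨b, e, fun p hp => hbe _ _ (hϱ p hp).1 (hϱ p hp).2⟩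
    have hPB : PairBounded B P := pairBounded_of_le fun p hp => (hbe p hp).1
    have hPL : PairBounded L P := pairBounded_of_le fun p hp => (hbe p hp).2
    refine ⟨pairBounded_of_le (c := 2 * (b + e / ε ^ 2) + 2 * ρ) fun p hp => ?_, hPB, hPL, ?_⟩
    · have h1 := (hbe p hp).1
      have h2 := div_le_div_of_nonneg_right (hbe p hp).2 hη.1.le
      linarith
    · exact hcount (pairSup_nonneg hB P) (pairSup_nonneg hL P)
        (hloc hl' hDnn hDsq (pairSup_nonneg hB P) (pairSup_nonneg hL P) fun p hp =>
          ⟨hPB.le_pairSup (hsub hp), hPL.le_pairSup (hsub hp)⟩)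

/-! ### Conjugates of real-valued convex functions -/

section Conjugate

variable {V : Type} [NormedAddCommGroup V] [NormedSpace ℝ V] {h : V → ℝ}

lemma le_conjValue {y : StrongDual ℝ V} (hy : y ∈ conjDomain h) (z : V) :
    y z - h z ≤ conjValue h y :=
  le_ciSup (f := fun z => y z - h z) hy z

lemma conjValue_le {y : StrongDual ℝ V} {c : ℝ} (hc : ∀ z, y z - h z ≤ c) :
    y ∈ conjDomain h ∧ conjValue h y ≤ c :=
  ⟨⟨c, by rintro _ ⟨z, rfl⟩; exact hc z⟩, ciSup_le hc⟩

lemma convexOn_conjValue : ConvexOn ℝ (conjDomain h) (conjValue h) := by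
  have key : ∀ y ∈ conjDomain h, ∀ y' ∈ conjDomain h, ∀ s t : ℝ, 0 ≤ s → 0 ≤ t → s + t = 1 →
      ∀ z, (s • y + t • y') z - h z ≤ s * conjValue h y + t * conjValue h y' := by
    intro y hy y' hy' s t hs ht hst z
    have h1 := mul_le_mul_of_nonneg_left (le_conjValue hy z) hs
    have h2 := mul_le_mul_of_nonneg_left (le_conjValue hy' z) ht
    have e : h z = s * h z + t * h z := by rw [← add_mul, hst, one_mul]
    simp only [add_apply, smul_apply, smul_eq_mul]
    linarith
  exact ⟨fun y hy y' hy' s t hs ht hst => (conjValue_le (key y hy y' hy' s t hs ht hst)).1,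
    fun y hy y' hy' s t hs ht hst => (conjValue_le (key y hy y' hy' s t hs ht hst)).2⟩

lemma lowerSemicontinuousOn_conjValue : LowerSemicontinuousOn (conjValue h) (conjDomain h) :=
  lowerSemicontinuousOn_ciSup (fun _ hy => hy) fun z =>
    (Continuous.lowerSemicontinuous (by fun_prop)).lowerSemicontinuousOn _

variable [FiniteDimensional ℝ V]

/-- The lower half of the Fenchel–Moreau theorem. -/
lemma exists_conjDomain_lt (hh : ConvexOn ℝ univ h) {z : V} {a : ℝ} (ha : a < h z) :
    ∃ y ∈ conjDomain h, a ≤ y z - conjValue h y := by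
  obtain ⟨l, c, hl, hz⟩ := hh.exists_affine_le_of_lt (𝕜 := ℝ) (mem_univ z) ha isClosed_univ
    ((hh.continuousOn isOpen_univ).lowerSemicontinuousOn)
  have hle : ∀ w, l w - h w ≤ -c := fun w => by
    have : l w + c ≤ h w := hl ⟨w, mem_univ w⟩
    linarith
  obtain ⟨h1, h2⟩ := conjValue_le hle
  refine ⟨l, h1, ?_⟩
  have : l z + c = a := hz
  linarith

/-- The domain of `h*` need not be closed, but a sublevel set of `h*` is an intersection of closed
half-spaces. -/
lemma isCompact_conjValue_le (hb : Bornology.IsBounded (conjDomain h)) (c : ℝ) :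
    IsCompact {y | y ∈ conjDomain h ∧ conjValue h y ≤ c} := by
  have e : {y | y ∈ conjDomain h ∧ conjValue h y ≤ c}
      = ⋂ z, {y : StrongDual ℝ V | y z - h z ≤ c} := by
    ext y
    simp only [mem_ofPred_eq, mem_iInter]
    exact ⟨fun hy z => (le_conjValue hy.1 z).trans hy.2, fun hy => conjValue_le hy⟩
  have : ProperSpace (StrongDual ℝ V) := FiniteDimensional.proper ℝ _
  refine Metric.isCompact_of_isClosed_isBounded ?_ (hb.subset fun y hy => hy.1)
  rw [e]
  exact isClosed_iInter fun z => isClosed_le (by fun_prop) continuous_const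

end Conjugate

/-! ### Smooth functions -/

/-- A function with an affine support at every point is convex. -/
lemma convexOn_of_forall_support {E : Type*} [NormedAddCommGroup E] [NormedSpace ℝ E] {F : E → ℝ}
    (hF : ∀ x, ∃ l : E →L[ℝ] ℝ, ∀ w, F x + l (w - x) ≤ F w) : ConvexOn ℝ univ F := by
  refine ⟨convex_univ, fun x _ y _ s t hs ht hst => ?_⟩
  obtain ⟨l, hl⟩ := hF (s • x + t • y)
  have h1 := mul_le_mul_of_nonneg_left (hl x) hs
  have h2 := mul_le_mul_of_nonneg_left (hl y) ht
  have e : s * l (x - (s • x + t • y)) + t * l (y - (s • x + t • y)) = 0 := by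
    rw [← smul_eq_mul, ← smul_eq_mul, ← map_smul, ← map_smul, ← map_add]
    have : s • (x - (s • x + t • y)) + t • (y - (s • x + t • y)) = 0 := by
      obtain rfl : t = 1 - s := by linarith
      module
    rw [this, map_zero]
  have e2 : F (s • x + t • y) = s * F (s • x + t • y) + t * F (s • x + t • y) := by
    rw [← add_mul, hst, one_mul]
  simp only [smul_eq_mul]
  linarith

/-- A smooth function that is bounded below has a small derivative where its value is small. -/
lemma norm_sq_le_of_bddBelow {E : Type*} [NormedAddCommGroup E] [InnerProductSpace ℝ E]
    [CompleteSpace E] {g : E → ℝ} {g' : E → E →L[ℝ] ℝ} {M b : ℝ} (hM : 0 < M)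
    (hg : ∀ u, HasFDerivAt g (g' u) u) (hlip : ∀ u v, ‖g' u - g' v‖ ≤ M * ‖u - v‖)
    (hb : ∀ u, b ≤ g u) (x : E) : ‖g' x‖ ^ 2 ≤ 2 * M * (g x - b) := by
  set v := (InnerProductSpace.toDual ℝ E).symm (g' x) with hv
  have hnorm : ‖v‖ = ‖g' x‖ := LinearIsometryEquiv.norm_map _ _
  have hgv : g' x v = ‖v‖ ^ 2 := by
    rw [← real_inner_self_eq_norm_sq, hv, InnerProductSpace.toDual_symm_apply]
  have h1 := le_add_fderiv_add_sq (M := M) (x := x) (y := x - M⁻¹ • v) hg (fun t ht => by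
    refine (hlip _ _).trans (le_of_eq ?_)
    rw [add_sub_cancel_left, norm_smul, Real.norm_of_nonneg ht.1])
  rw [show x - M⁻¹ • v - x = -(M⁻¹ • v) by abel, map_neg, map_smul, hgv, norm_neg, norm_smul,
    Real.norm_of_nonneg (by positivity), smul_eq_mul, hnorm] at h1
  have h2 := hb (x - M⁻¹ • v)
  have e : M / 2 * (M⁻¹ * ‖g' x‖) ^ 2 = M⁻¹ * ‖g' x‖ ^ 2 / 2 := by field_simp
  rw [e] at h1
  have h3 : M⁻¹ * ‖g' x‖ ^ 2 ≤ 2 * (g x - b) := by linarith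
  rw [inv_mul_le_iff₀ hM] at h3
  linarith

namespace NesterovSmoothing

variable {d : ℕ} (N : NesterovSmoothing d)

instance finiteDimensional : FiniteDimensional ℝ N.V := N.basis.finiteDimensional_of_finite

lemma conjDomain_nonempty : (conjDomain N.h).Nonempty := by
  obtain ⟨y, hy, -⟩ := exists_conjDomain_lt N.h_convex (sub_one_lt (N.h 0))
  exact ⟨y, hy⟩

lemma norm_le_dualRadius {y : StrongDual ℝ N.V} (hy : y ∈ conjDomain N.h) : ‖y‖ ≤ N.dualRadius := by
  obtain ⟨c, hc⟩ := N.dom_bounded.exists_norm_le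
  exact le_csSup ⟨c, by rintro _ ⟨y, hy, rfl⟩; exact hc y hy⟩ ⟨y, hy, rfl⟩

lemma dualRadius_nonneg : 0 ≤ N.dualRadius :=
  Real.sSup_nonneg (by rintro _ ⟨y, -, rfl⟩; exact norm_nonneg _)

lemma ω_le_proxDiam {y : StrongDual ℝ N.V} (hy : y ∈ conjDomain N.h) : N.ω y ≤ N.proxDiam :=
  le_csSup N.ω_bounded ⟨y, hy, rfl⟩

lemma proxDiam_nonneg : 0 ≤ N.proxDiam := by
  obtain ⟨y, hy⟩ := N.conjDomain_nonempty
  exact (N.ω_nonneg y hy).trans (N.ω_le_proxDiam hy)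

/-- `y` attains the supremum that defines `h_η(z)`. -/
structure IsDualOpt (η : ℝ) (z : N.V) (y : StrongDual ℝ N.V) : Prop where
  mem : y ∈ conjDomain N.h
  le : ∀ y' ∈ conjDomain N.h,
    y' z - conjValue N.h y' - η * N.ω y' ≤ y z - conjValue N.h y - η * N.ω y

variable {N} {η : ℝ}

lemma exists_isDualOpt (hη : 0 < η) (z : N.V) : ∃ y, N.IsDualOpt η z y := by
  obtain ⟨y0, hy0⟩ := N.conjDomain_nonempty
  set F : StrongDual ℝ N.V → ℝ := fun y => conjValue N.h y + η * N.ω y + -(y z) with hF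
  have hlsc : LowerSemicontinuousOn F (conjDomain N.h) := by
    refine (lowerSemicontinuousOn_conjValue.add ?_).add ?_
    · exact (Continuous.comp_lowerSemicontinuousOn (g := fun s : ℝ => η * s) (by fun_prop)
        N.ω_lsc (fun a b hab => mul_le_mul_of_nonneg_left hab hη.le))
    · exact (Continuous.lowerSemicontinuous (by fun_prop)).lowerSemicontinuousOn _
  -- This level makes `F y' ≥ F y0` wherever `h*(y') > c`, so minimizing over the compact sublevel
  -- set is enough.
  set c := max (conjValue N.h y0) (F y0 + N.dualRadius * ‖z‖) with hc
  obtain ⟨y, hy, hmin⟩ := LowerSemicontinuousOn.exists_isMinOn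
    (s := {y | y ∈ conjDomain N.h ∧ conjValue N.h y ≤ c}) ⟨y0, hy0, le_max_left _ _⟩
    (isCompact_conjValue_le N.dom_bounded c) (hlsc.mono fun y hy => hy.1)
  rw [isMinOn_iff] at hmin
  have key : ∀ y' ∈ conjDomain N.h, F y ≤ F y' := by
    intro y' hy'
    by_cases hle : conjValue N.h y' ≤ c
    · exact hmin y' ⟨hy', hle⟩
    · refine (hmin y0 ⟨hy0, le_max_left _ _⟩).trans ?_
      have h1 : F y0 + N.dualRadius * ‖z‖ ≤ conjValue N.h y' := (le_max_right _ _).trans (not_le.1 hle).le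
      have h2 := mul_nonneg hη.le (N.ω_nonneg y' hy')
      have h3 := (le_abs_self (y' z)).trans (y'.le_of_opNorm_le (N.norm_le_dualRadius hy') z)
      simp only [hF] at h1 ⊢
      linarith
  refine ⟨y, hy.1, fun y' hy' => ?_⟩
  have := key y' hy'
  simp only [hF] at this
  linarith

lemma IsDualOpt.hη_eq {z : N.V} {y : StrongDual ℝ N.V} (h : N.IsDualOpt η z y) :
    N.hη η z = y z - conjValue N.h y - η * N.ω y := by
  have : Nonempty (conjDomain N.h) := ⟨⟨y, h.mem⟩⟩
  refine le_antisymm (ciSup_le fun y' => h.le y' y'.2) ?_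
  exact le_ciSup (f := fun y' : conjDomain N.h =>
    (y' : StrongDual ℝ N.V) z - conjValue N.h y' - η * N.ω y')
    ⟨_, by rintro _ ⟨y', rfl⟩; exact h.le y' y'.2⟩ ⟨y, h.mem⟩

lemma IsDualOpt.add_le {z w : N.V} {y : StrongDual ℝ N.V} (hη : 0 < η) (h : N.IsDualOpt η z y) :
    N.hη η z + y (w - z) ≤ N.hη η w := by
  obtain ⟨y', hy'⟩ := exists_isDualOpt hη w
  rw [h.hη_eq, hy'.hη_eq, map_sub]
  linarith [hy'.le y h.mem]

lemma hη_le (hη : 0 < η) (z : N.V) : N.hη η z ≤ N.h z := by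
  obtain ⟨y, hy⟩ := exists_isDualOpt hη z
  rw [hy.hη_eq]
  linarith [le_conjValue hy.mem z, mul_nonneg hη.le (N.ω_nonneg y hy.mem)]

/-- A dual point that nearly attains `h z` competes in the supremum for `h_η`, losing at most `η sup
ω`. -/
lemma le_hη_add (hη : 0 < η) (z : N.V) : N.h z ≤ N.hη η z + η * N.proxDiam := by
  refine le_of_forall_lt_imp_le_of_dense fun a ha => ?_
  obtain ⟨y, hy, hay⟩ := exists_conjDomain_lt N.h_convex ha
  obtain ⟨y', hy'⟩ := exists_isDualOpt hη z
  rw [hy'.hη_eq]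
  linarith [hy'.le y hy, mul_le_mul_of_nonneg_left (N.ω_le_proxDiam hy) hη.le]

lemma IsDualOpt.add_sq_le {z : N.V} {y y' : StrongDual ℝ N.V} (hη : 0 < η)
    (h : N.IsDualOpt η z y) (hy' : y' ∈ conjDomain N.h) :
    y' z - conjValue N.h y' - η * N.ω y' + η * N.σ / 2 * ‖y' - y‖ ^ 2
      ≤ y z - conjValue N.h y - η * N.ω y := by
  have hsc : StrongConvexOn (conjDomain N.h) (η * N.σ)
      (fun y => conjValue N.h y + η * N.ω y - y z) := by
    refine ⟨convexOn_conjValue.1, fun u hu v hv s t hs ht hst => ?_⟩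
    have h1 := convexOn_conjValue.2 hu hv hs ht hst
    have h2 := mul_le_mul_of_nonneg_left (N.ω_strongConvex.2 hu hv hs ht hst) hη.le
    simp only [smul_eq_mul, add_apply, smul_apply] at h1 h2 ⊢
    linarith
  have := hsc.add_sq_le_of_isMin h.mem hy' (fun u hu => by linarith [h.le u hu])
  linarith

/-- The dual solution is Lipschitz in `z`. -/
lemma IsDualOpt.norm_sub_le {z w : N.V} {y y' : StrongDual ℝ N.V} (hη : 0 < η)
    (h : N.IsDualOpt η z y) (h' : N.IsDualOpt η w y') :
    ‖y - y'‖ ≤ (η * N.σ)⁻¹ * ‖z - w‖ := by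
  have hσ := mul_pos hη N.σ_pos
  -- The two quadratic growth inequalities add up to `ησ‖y - y'‖² ≤ (y - y')(z - w)`.
  have h1 := h.add_sq_le hη h'.mem
  have h2 := h'.add_sq_le hη h.mem
  rw [norm_sub_rev] at h1
  have h3 := (le_abs_self _).trans ((y - y').le_opNorm (z - w))
  simp only [sub_apply, map_sub] at h3
  rw [le_inv_mul_iff₀ hσ]
  rcases (norm_nonneg (y - y')).eq_or_lt with h0 | h0
  · rw [← h0, mul_zero]; exact norm_nonneg _
  · refine le_of_mul_le_mul_left ?_ h0
    linarith

/-- The remainder at `w` lies between `0` and `(y' - y)(w - z)` with `y'` optimal at `w`; this is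
quadratic because dual solutions are Lipschitz. -/
lemma IsDualOpt.hasFDerivAt {z : N.V} {y : StrongDual ℝ N.V} (hη : 0 < η)
    (h : N.IsDualOpt η z y) : HasFDerivAt (N.hη η) y z := by
  have hσ := mul_pos hη N.σ_pos
  rw [hasFDerivAt_iff_isLittleO]
  refine Asymptotics.IsBigO.trans_isLittleO (g := fun w => ‖w - z‖ ^ 2) ?_ ?_
  · refine Asymptotics.IsBigO.of_bound ((η * N.σ)⁻¹) (Eventually.of_forall fun w => ?_)
    obtain ⟨y', hy'⟩ := exists_isDualOpt hη w
    have h1 := h.add_le hη (w := w)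
    have h2 := hy'.add_le hη (w := z)
    have h3 := (le_abs_self _).trans ((y' - y).le_of_opNorm_le (hy'.norm_sub_le hη h) (w - z))
    rw [sub_apply] at h3
    rw [← neg_sub w z, map_neg] at h2
    rw [Real.norm_of_nonneg (by linarith), Real.norm_of_nonneg (sq_nonneg _)]
    linarith
  · have : Tendsto (fun w => ‖w - z‖) (𝓝 z) (𝓝 0) := by
      have := (continuous_id.sub continuous_const : Continuous fun w : N.V => w - z).norm.tendsto z
      simpa using this
    have h2 := (Asymptotics.isLittleO_one_iff ℝ).2 this
    have h3 := h2.mul_isBigO (Asymptotics.isBigO_refl (fun w => ‖w - z‖) (𝓝 z))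
    simp only [one_mul] at h3
    simpa [pow_two] using h3.norm_right.trans_isBigO (Asymptotics.isBigO_norm_left.2 (by
      simpa using Asymptotics.isBigO_refl _ _))

end NesterovSmoothing

namespace NesterovSmoothing

variable {d : ℕ} (N : NesterovSmoothing d)

/-! ### The inner map -/

lemma hasFDerivAt_A (x : Eucl d) : HasFDerivAt N.A (fderiv ℝ N.A x) x :=
  (N.A_contDiff.differentiable one_ne_zero x).hasFDerivAt

lemma norm_fderiv_le (u v : Eucl d) :
    ‖fderiv ℝ N.A u‖ ≤ ‖fderiv ℝ N.A v‖ + N.LA * ‖u - v‖ := by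
  have h1 := N.A_smooth u v
  have h2 := norm_sub_norm_le (fderiv ℝ N.A u) (fderiv ℝ N.A v)
  linarith

lemma segment_mem_closedBall {c u v : Eucl d} {D t : ℝ} (hu : u ∈ Metric.closedBall c D)
    (hv : v ∈ Metric.closedBall c D) (ht : t ∈ Icc (0 : ℝ) 1) :
    t • u + (1 - t) • v ∈ Metric.closedBall c D :=
  convex_closedBall c D hu hv ht.1 (by linarith [ht.2]) (by ring)

lemma norm_fderiv_le_of_mem_closedBall {c w : Eucl d} {G D : ℝ} (hG : ‖fderiv ℝ N.A c‖ ≤ G)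
    (hw : w ∈ Metric.closedBall c D) : ‖fderiv ℝ N.A w‖ ≤ G + N.LA * D := by
  have h1 := N.norm_fderiv_le w c
  have h2 := mul_le_mul_of_nonneg_left (mem_closedBall_iff_norm.1 hw) N.LA_nonneg
  linarith

lemma jacModulus_le_of_forall {u v : Eucl d} {s : ℝ}
    (h : ∀ t ∈ Icc (0 : ℝ) 1, ‖fderiv ℝ N.A (t • u + (1 - t) • v)‖ ^ 2 ≤ s) :
    N.jacModulus u v ≤ N.σ⁻¹ * s :=
  mul_le_mul_of_nonneg_left (ciSup_le fun t => h t t.2) (inv_nonneg.2 N.σ_pos.le)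

lemma jacModulus_le {c u v : Eucl d} {G D : ℝ} (hG : ‖fderiv ℝ N.A c‖ ≤ G)
    (hu : u ∈ Metric.closedBall c D) (hv : v ∈ Metric.closedBall c D) :
    N.jacModulus u v ≤ N.σ⁻¹ * (G + N.LA * D) ^ 2 :=
  N.jacModulus_le_of_forall fun _ ht => pow_le_pow_left₀ (norm_nonneg _)
    (N.norm_fderiv_le_of_mem_closedBall hG (segment_mem_closedBall hu hv ht)) 2

lemma norm_fderiv_sq_le {u v : Eucl d} {t : ℝ} (ht : t ∈ Icc (0 : ℝ) 1) :
    ‖fderiv ℝ N.A (t • u + (1 - t) • v)‖ ^ 2 ≤ N.σ * N.jacModulus u v := by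
  rw [jacModulus, mul_inv_cancel_left₀ N.σ_pos.ne']
  refine le_ciSup (f := fun t : Icc (0 : ℝ) 1 =>
    ‖fderiv ℝ N.A ((t : ℝ) • u + (1 - (t : ℝ)) • v)‖ ^ 2)
    ⟨(‖fderiv ℝ N.A v‖ + N.LA * ‖u - v‖) ^ 2, ?_⟩ ⟨t, ht⟩
  rintro _ ⟨s, rfl⟩
  exact pow_le_pow_left₀ (norm_nonneg _) (N.norm_fderiv_le_of_mem_closedBall le_rfl
    (segment_mem_closedBall (by rw [mem_closedBall_iff_norm])
      (Metric.mem_closedBall_self (norm_nonneg _)) s.2)) 2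

lemma jacModulus_nonneg (u v : Eucl d) : 0 ≤ N.jacModulus u v :=
  mul_nonneg (inv_nonneg.2 N.σ_pos.le) (Real.iSup_nonneg fun _ => sq_nonneg _)

lemma jacModulus_comm (u v : Eucl d) : N.jacModulus u v = N.jacModulus v u := by
  have key : ∀ u v, N.jacModulus u v ≤ N.jacModulus v u := fun u v => by
    have := N.jacModulus_le_of_forall (u := u) (v := v) (s := N.σ * N.jacModulus v u)
      fun t ht => by
        have := N.norm_fderiv_sq_le (u := v) (v := u) (t := 1 - t)
          ⟨by linarith [ht.2], by linarith [ht.1]⟩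
        rwa [sub_sub_cancel, add_comm] at this
    rwa [inv_mul_cancel_left₀ N.σ_pos.ne'] at this
  exact le_antisymm (key u v) (key v u)

lemma norm_fderiv_le_sqrt {u v w : Eucl d} (hw : w ∈ segment ℝ u v) :
    ‖fderiv ℝ N.A w‖ ≤ √(N.σ * N.jacModulus u v) := by
  obtain ⟨a, b, ha, hb, hab, rfl⟩ := hw
  obtain rfl : b = 1 - a := by linarith
  exact Real.le_sqrt_of_sq_le (N.norm_fderiv_sq_le ⟨ha, by linarith⟩)

lemma norm_A_sub_le (u v : Eucl d) :
    ‖N.A u - N.A v‖ ≤ √(N.σ * N.jacModulus u v) * ‖u - v‖ :=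
  (convex_segment u v).norm_image_sub_le_of_norm_fderiv_le (𝕜 := ℝ)
    (fun x _ => N.A_contDiff.differentiable one_ne_zero x)
    (fun _ hx => N.norm_fderiv_le_sqrt hx) (right_mem_segment ℝ u v) (left_mem_segment ℝ u v)

lemma hasFDerivAt_dual_comp_A (y : StrongDual ℝ N.V) (u : Eucl d) :
    HasFDerivAt (fun x => y (N.A x)) (y.comp (fderiv ℝ N.A u)) u :=
  y.hasFDerivAt.comp u (N.hasFDerivAt_A u)

lemma norm_dual_comp_sub_le (y : StrongDual ℝ N.V) (u v : Eucl d) :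
    ‖y.comp (fderiv ℝ N.A u) - y.comp (fderiv ℝ N.A v)‖ ≤ ‖y‖ * N.LA * ‖u - v‖ := by
  rw [← ContinuousLinearMap.comp_sub, mul_assoc]
  exact (y.opNorm_comp_le _).trans (mul_le_mul_of_nonneg_left (N.A_smooth u v) (norm_nonneg y))

lemma dual_A_ge (y : StrongDual ℝ N.V) (x w : Eucl d) :
    y (N.A x) + y (fderiv ℝ N.A x (w - x)) - ‖y‖ * N.LA / 2 * ‖w - x‖ ^ 2 ≤ y (N.A w) := by
  have := le_add_fderiv_add_sq (M := ‖y‖ * N.LA) (x := x) (y := w)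
    (N.hasFDerivAt_dual_comp_A (-y)) (fun t ht => by
      refine (N.norm_dual_comp_sub_le (-y) _ _).trans (le_of_eq ?_)
      rw [add_sub_cancel_left, norm_smul, Real.norm_of_nonneg ht.1, norm_neg])
  simp only [neg_apply, ContinuousLinearMap.comp_apply] at this
  linarith

/-! ### Nesterov smoothing as a smooth approximation -/

variable {N} {η : ℝ}

lemma IsDualOpt.hasFDerivAt_comp {x : Eucl d} {y : StrongDual ℝ N.V} (hη : 0 < η)
    (h : N.IsDualOpt η (N.A x) y) :
    HasFDerivAt (fun x => N.hη η (N.A x)) (y.comp (fderiv ℝ N.A x)) x :=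
  (h.hasFDerivAt hη).comp x (N.hasFDerivAt_A x)

lemma contDiff_hη_comp (hη : 0 < η) : ContDiff ℝ 1 (fun x => N.hη η (N.A x)) := by
  refine ContDiff.comp (g := N.hη η) ?_ N.A_contDiff
  choose y hy using fun z => exists_isDualOpt (N := N) hη z
  refine contDiff_one_iff_hasFDerivAt.2 ⟨y, ?_, fun z => (hy z).hasFDerivAt hη⟩
  have hK : 0 ≤ (η * N.σ)⁻¹ := inv_nonneg.2 (mul_pos hη N.σ_pos).le
  refine (LipschitzWith.of_dist_le_mul (K := ⟨_, hK⟩) fun z w => ?_).continuous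
  rw [dist_eq_norm, dist_eq_norm]
  exact (hy z).norm_sub_le hη (hy w)

/-- A dual optimum `y` at `A x` supports `h_η` there. Composed with `A`, the support bends by at
most `‖y‖ L_A ≤ ρ`, so adding the quadratic leaves an affine support at `x`. -/
lemma isWeaklyConvex_hη_comp (hη : 0 < η) {ρ : ℝ} (hρ : N.dualRadius * N.LA ≤ ρ) :
    IsWeaklyConvex ρ (fun x => N.hη η (N.A x)) := by
  refine convexOn_of_forall_support fun x => ?_
  obtain ⟨y, hy⟩ := exists_isDualOpt hη (N.A x)
  refine ⟨y.comp (fderiv ℝ N.A x) + ρ • innerSL ℝ x, fun w => ?_⟩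
  have h1 := hy.add_le hη (w := N.A w)
  have h2 := N.dual_A_ge y x w
  have h3 : ‖y‖ * N.LA ≤ ρ :=
    (mul_le_mul_of_nonneg_right (N.norm_le_dualRadius hy.mem) N.LA_nonneg).trans hρ
  have h4 := mul_le_mul_of_nonneg_right h3 (sq_nonneg ‖w - x‖)
  have h5 : ‖w‖ ^ 2 = ‖x‖ ^ 2 + 2 * inner ℝ x (w - x) + ‖w - x‖ ^ 2 := by
    rw [← norm_add_sq_real, add_sub_cancel]
  rw [map_sub] at h1
  simp only [add_apply, ContinuousLinearMap.comp_apply, smul_apply, innerSL_apply_apply, smul_eq_mul]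
  rw [h5]
  linarith

/-- Varying the Jacobian costs `‖y‖ L_A`. Varying the dual solution costs `1/(ησ)` times `√(σJ)`
twice, where `J` is `jacModulus u v`: once for `‖A u - A v‖`, once for the Jacobian at `v`. -/
lemma norm_gradient_sub_le (hη : 0 < η) (u v : Eucl d) :
    ‖gradient (fun x => N.hη η (N.A x)) u - gradient (fun x => N.hη η (N.A x)) v‖
      ≤ (N.dualRadius * N.LA + N.jacModulus u v / η) * ‖u - v‖ := by
  obtain ⟨y, hy⟩ := exists_isDualOpt hη (N.A u)
  obtain ⟨y', hy'⟩ := exists_isDualOpt hη (N.A v)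
  rw [gradient, gradient, ← map_sub, LinearIsometryEquiv.norm_map,
    (hy.hasFDerivAt_comp hη).fderiv, (hy'.hasFDerivAt_comp hη).fderiv,
    show y.comp (fderiv ℝ N.A u) - y'.comp (fderiv ℝ N.A v)
      = (y.comp (fderiv ℝ N.A u) - y.comp (fderiv ℝ N.A v)) + (y - y').comp (fderiv ℝ N.A v) by
        rw [ContinuousLinearMap.sub_comp]; abel]
  refine (norm_add_le _ _).trans ?_
  rw [add_mul]
  refine add_le_add ((N.norm_dual_comp_sub_le y u v).trans ?_) ?_
  · exact mul_le_mul_of_nonneg_right (mul_le_mul_of_nonneg_right (N.norm_le_dualRadius hy.mem)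
      N.LA_nonneg) (norm_nonneg _)
  · have hJ : 0 ≤ N.σ * N.jacModulus u v := mul_nonneg N.σ_pos.le (N.jacModulus_nonneg u v)
    have hK : 0 ≤ (η * N.σ)⁻¹ := inv_nonneg.2 (mul_pos hη N.σ_pos).le
    have h1 : ‖y - y'‖ ≤ (η * N.σ)⁻¹ * (√(N.σ * N.jacModulus u v) * ‖u - v‖) :=
      (hy.norm_sub_le hη hy').trans (mul_le_mul_of_nonneg_left (N.norm_A_sub_le u v) hK)
    calc ‖(y - y').comp (fderiv ℝ N.A v)‖ ≤ ‖y - y'‖ * ‖fderiv ℝ N.A v‖ :=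
          (y - y').opNorm_comp_le _
      _ ≤ (η * N.σ)⁻¹ * (√(N.σ * N.jacModulus u v) * ‖u - v‖) * √(N.σ * N.jacModulus u v) :=
          mul_le_mul h1 (N.norm_fderiv_le_sqrt (right_mem_segment ℝ u v)) (norm_nonneg _)
            (by positivity)
      _ = (η * N.σ)⁻¹ * √(N.σ * N.jacModulus u v) ^ 2 * ‖u - v‖ := by ring
      _ = N.jacModulus u v / η * ‖u - v‖ := by
          have := N.σ_pos.ne'
          rw [Real.sq_sqrt hJ]
          field_simp

lemma isSmoothApprox (hη : 0 < η) {ρ : ℝ} (hρ : N.dualRadius * N.LA ≤ ρ) :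
    IsSmoothApprox (fun x => N.h (N.A x)) (fun x => N.hη η (N.A x)) ρ (fun _ => η * N.proxDiam)
      (fun x y => N.dualRadius * N.LA + N.jacModulus x y / η) where
  contDiff := contDiff_hη_comp hη
  weaklyConvex := isWeaklyConvex_hη_comp hη hρ
  error_nonneg _ := mul_nonneg hη.le N.proxDiam_nonneg
  modulus_nonneg x y := add_nonneg (mul_nonneg N.dualRadius_nonneg N.LA_nonneg)
    (div_nonneg (N.jacModulus_nonneg x y) hη.le)
  modulus_symm x y := by rw [N.jacModulus_comm]
  lower x := hη_le hη _
  upper x := le_hη_add hη _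
  smooth u v := norm_gradient_sub_le hη u v

/-- If the coordinates of `A` are bounded below, the Jacobian of `A` is bounded on preimages of
bounded sets. -/
lemma exists_norm_fderiv_le (hA : ∀ i, BddBelow (range fun x => N.basis.repr (N.A x) i))
    (c : ℝ) : ∃ G, ∀ x, ‖N.A x‖ ≤ c → ‖fderiv ℝ N.A x‖ ≤ G := by
  let φ : Fin N.m → StrongDual ℝ N.V := fun i => LinearMap.toContinuousLinearMap (N.basis.coord i)
  have hφ : ∀ i z, φ i z = N.basis.repr z i := fun i z => rfl
  choose b hb using hA
  have hb' : ∀ i x, b i ≤ φ i (N.A x) := fun i x => hb i ⟨x, rfl⟩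
  let M : Fin N.m → ℝ := fun i => ‖φ i‖ * N.LA + 1
  have hM : ∀ i, 0 < M i := fun i => by
    have := mul_nonneg (norm_nonneg (φ i)) N.LA_nonneg
    simp only [M]
    linarith
  refine ⟨∑ i, √(2 * M i * (‖φ i‖ * c - b i)) * ‖N.basis i‖, fun x hx => ?_⟩
  have hc : 0 ≤ c := (norm_nonneg _).trans hx
  refine ContinuousLinearMap.opNorm_le_bound _
    (Finset.sum_nonneg fun i _ => mul_nonneg (Real.sqrt_nonneg _) (norm_nonneg _)) fun v => ?_
  have e : fderiv ℝ N.A x v = ∑ i, φ i (fderiv ℝ N.A x v) • N.basis i :=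
    (N.basis.sum_repr (fderiv ℝ N.A x v)).symm
  rw [e, Finset.sum_mul]
  refine (norm_sum_le _ _).trans (Finset.sum_le_sum fun i _ => ?_)
  -- Each coordinate of `A` is bounded below with Lipschitz derivative, so its value, at most `‖φ i‖
  -- c`, controls its derivative. The `+ 1` in `M i` only ensures positivity.
  have h1 := norm_sq_le_of_bddBelow (hM i) (N.hasFDerivAt_dual_comp_A (φ i)) (fun u v =>
    (N.norm_dual_comp_sub_le (φ i) u v).trans (mul_le_mul_of_nonneg_right
      (by simp only [M]; linarith) (norm_nonneg _))) (hb' i) x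
  have h2 : φ i (N.A x) ≤ ‖φ i‖ * c :=
    (le_abs_self _).trans (((φ i).le_opNorm _).trans
      (mul_le_mul_of_nonneg_left hx (norm_nonneg _)))
  have h3 : ‖(φ i).comp (fderiv ℝ N.A x)‖ ≤ √(2 * M i * (‖φ i‖ * c - b i)) :=
    Real.le_sqrt_of_sq_le (h1.trans (mul_le_mul_of_nonneg_left (by linarith)
      (by linarith [hM i])))
  rw [norm_smul, mul_right_comm]
  exact mul_le_mul_of_nonneg_right (((φ i).comp (fderiv ℝ N.A x)).le_of_opNorm_le h3 v)
    (norm_nonneg _)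

end NesterovSmoothing

/-! ### Uniform bounds on the moduli -/

/-- The initial sublevel sets of the smoothed objectives lie in one sublevel set of the original
objective. -/
lemma IsSmoothApprox.le_of_mem_initialLevel {d : ℕ} {f fs : Eucl d → ℝ} {r : Eucl d → EReal}
    {ρ b : ℝ} {Rs : Eucl d → ℝ} {Ls : Eucl d → Eucl d → ℝ} {x0 x : Eucl d}
    (hs : IsSmoothApprox f fs ρ Rs Ls) (hbot : ∀ x, r x ≠ ⊥) (hx0 : r x0 ≠ ⊤)
    (hx : x ∈ initialLevel (composite fs r) x0) (hb : Rs x ≤ b) :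
    r x ≠ ⊤ ∧ f x + (r x).toReal ≤ f x0 + (r x0).toReal + b := by
  obtain ⟨h1, h2⟩ := (mem_initialLevel_iff hbot hx0).1 hx
  exact ⟨h1, by linarith [hs.upper x, hs.lower x0]⟩

lemma exists_bound_on_closedBall {d : ℕ} {B : Eucl d → Eucl d → ℝ}
    (hB : Continuous (fun p : Eucl d × Eucl d => B p.1 p.2)) (ϱ : ℝ) :
    ∃ b, ∀ x y : Eucl d, ‖x‖ ≤ ϱ → ‖y‖ ≤ ϱ → B x y ≤ b := by
  have hc : IsCompact (Metric.closedBall (0 : Eucl d) ϱ ×ˢ Metric.closedBall (0 : Eucl d) ϱ) :=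
    (isCompact_closedBall _ _).prod (isCompact_closedBall _ _)
  obtain ⟨b, hb⟩ := hc.bddAbove_image hB.continuousOn
  exact ⟨b, fun x y hx hy => hb ⟨(x, y), ⟨by simpa using hx, by simpa using hy⟩, rfl⟩⟩

lemma IsWeaklyConvex.continuous {d : ℕ} {ρ : ℝ} {f : Eucl d → ℝ} (hf : IsWeaklyConvex ρ f) :
    Continuous f := by
  have h1 : Continuous (fun x => f x + ρ / 2 * ‖x‖ ^ 2) :=
    continuousOn_univ.1 (ConvexOn.continuousOn isOpen_univ hf)
  have h2 : Continuous (fun x => f x + ρ / 2 * ‖x‖ ^ 2 - ρ / 2 * ‖x‖ ^ 2) :=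
    h1.sub (by fun_prop)
  simpa using h2

section

variable {d : ℕ} {f : Eucl d → ℝ} {r : Eucl d → EReal} {fη Rη : ℝ → Eucl d → ℝ}
  {B L : Eucl d → Eucl d → ℝ} {x0 : Eucl d} {ρ R θ : ℝ}

/-- With level-bounded smoothed objectives, continuous moduli are bounded around the initial
sublevel sets. -/
lemma exists_ball_bound_of_levelBounded (hθ : 0 < θ) (hR : 0 ≤ R) (hbot : ∀ x, r x ≠ ⊥)
    (hx0 : r x0 ≠ ⊤)
    (herr : ∀ η ∈ Ioc 0 θ, ∀ x ∈ initialLevel (composite (fη η) r) x0, Rη η x ≤ R * η)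
    (hsm : ∀ η ∈ Ioc 0 θ, IsSmoothApprox f (fη η) ρ (Rη η) (fun x y => B x y + L x y / η))
    (hlev : LevelBounded (composite (fη θ) r))
    (hbdd : ∀ ϱ : ℝ, ∃ b e : ℝ, ∀ x y : Eucl d, ‖x‖ ≤ ϱ → ‖y‖ ≤ ϱ → B x y ≤ b ∧ L x y ≤ e)
    (D : ℝ) : ∃ b e : ℝ, ∀ η ∈ Ioc 0 θ,
      ∀ p ∈ commonBallPairs (initialLevel (composite (fη η) r) x0) D,
        B p.1 p.2 ≤ b ∧ L p.1 p.2 ≤ e := by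
  -- Every `S₀` lies in `{φ ≤ φ(x0) + Rθ}`, hence in one sublevel set of `φ_θ`, because `f_θ ≤ f`.
  obtain ⟨c, hc⟩ := (hlev (f x0 + (r x0).toReal + R * θ)).exists_norm_le
  obtain ⟨b, e, hbe⟩ := hbdd (c + D)
  refine ⟨b, e, fun η hη p hp => ?_⟩
  obtain ⟨s, hs, h1, h2⟩ := hp
  obtain ⟨hst, hsl⟩ := (hsm η hη).le_of_mem_initialLevel hbot hx0 hs
    ((herr η hη s hs).trans (mul_le_mul_of_nonneg_left hη.2 hR))
  have hsc : ‖s‖ ≤ c := by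
    refine hc s ?_
    rw [mem_ofPred_eq, composite_eq_coe hbot hst, EReal.coe_le_coe_iff]
    linarith [(hsm θ ⟨hθ, le_rfl⟩).lower s]
  have key : ∀ u ∈ Metric.closedBall s D, ‖u‖ ≤ c + D := fun u hu => by
    have h3 := norm_add_le s (u - s)
    rw [add_sub_cancel] at h3
    linarith [mem_closedBall_iff_norm.1 hu]
  exact hbe _ _ (key _ h1) (key _ h2)

namespace NesterovSmoothing

variable (N : NesterovSmoothing d)

lemma exists_bound (hL : ∀ x y, B x y = N.dualRadius * N.LA ∧ L x y = N.jacModulus x y) (ϱ : ℝ) :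
    ∃ b e : ℝ, ∀ x y : Eucl d, ‖x‖ ≤ ϱ → ‖y‖ ≤ ϱ → B x y ≤ b ∧ L x y ≤ e :=
  ⟨_, _, fun x y hx hy => ⟨(hL x y).1.le, (hL x y).2.le.trans
    (N.jacModulus_le (c := 0) le_rfl (by simpa using hx) (by simpa using hy))⟩⟩

/-- With level-bounded `h_θ` and lower-bounded coordinates of `A`, the Jacobian is bounded around
the initial sublevel sets. -/
lemma exists_ball_bound (hθ : 0 < θ) (hR : 0 ≤ R) {a : ℝ} (ha : ∀ x, (a : EReal) ≤ r x)
    (hx0 : r x0 ≠ ⊤) (hf : ∀ x, f x = N.h (N.A x))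
    (herr : ∀ η ∈ Ioc 0 θ, ∀ x ∈ initialLevel (composite (fη η) r) x0, Rη η x ≤ R * η)
    (hsm : ∀ η ∈ Ioc 0 θ, IsSmoothApprox f (fη η) ρ (Rη η) (fun x y => B x y + L x y / η))
    (hL : ∀ x y, B x y = N.dualRadius * N.LA ∧ L x y = N.jacModulus x y)
    (hlev : ∀ v : ℝ, Bornology.IsBounded {z | N.hη θ z ≤ v})
    (hA : ∀ i, BddBelow (range fun x => N.basis.repr (N.A x) i))
    (D : ℝ) : ∃ b e : ℝ, ∀ η ∈ Ioc 0 θ,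
      ∀ p ∈ commonBallPairs (initialLevel (composite (fη η) r) x0) D,
        B p.1 p.2 ≤ b ∧ L p.1 p.2 ≤ e := by
  have hbot := ne_bot_of_coe_le ha
  -- Removing the lower bound `a` of `r` leaves a sublevel set of `h_θ` that contains the images
  -- under `A` of all the sets `S₀`.
  obtain ⟨c, hc⟩ := (hlev (f x0 + (r x0).toReal + R * θ - a)).exists_norm_le
  obtain ⟨G, hG⟩ := exists_norm_fderiv_le hA c
  refine ⟨N.dualRadius * N.LA, N.σ⁻¹ * (G + N.LA * D) ^ 2, fun η hη p hp => ?_⟩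
  obtain ⟨s, hs, h1, h2⟩ := hp
  obtain ⟨hst, hsl⟩ := (hsm η hη).le_of_mem_initialLevel hbot hx0 hs
    ((herr η hη s hs).trans (mul_le_mul_of_nonneg_left hη.2 hR))
  have has : a ≤ (r s).toReal := by
    have := ha s
    rwa [← EReal.coe_toReal hst (hbot s), EReal.coe_le_coe_iff] at this
  have hsc : ‖N.A s‖ ≤ c := by
    refine hc _ ?_
    rw [mem_ofPred_eq]
    have := N.hη_le hθ (N.A s)
    rw [hf s] at hsl
    linarith
  exact ⟨(hL _ _).1.le, (hL _ _).2.le.trans (N.jacModulus_le (hG s hsc) h1 h2)⟩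

end NesterovSmoothing

end

/-! ### The main theorem: reduction of cases (A) and (B) to the common complexity bound -/

theorem mainTheorem2 (ρ ρbar R : ℝ) (hρ : 0 < ρ) (hρbar : 0 < ρbar) (hR : 0 ≤ R) :
    -- accuracy constant, depending only on `ρ, ρbar, R`
    ∃ c > (0 : ℝ), ∀ θ Δ τu L0 : ℝ, 0 < θ → 0 ≤ Δ → 1 < τu → 0 < L0 →
    -- complexity constant, independent of the problem instance and of the accuracy
    ∃ C > (0 : ℝ), ∀ (d : ℕ) (f : Eucl d → ℝ) (r : Eucl d → EReal) (fη Rη : ℝ → Eucl d → ℝ)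
      (B L : Eucl d → Eucl d → ℝ) (x0 : Eucl d) (τd : ℝ),
      0 < τd → τd < 1 →
      -- the composite problem
      IsWeaklyConvex ρ f →
      IsConvexExt r → LowerSemicontinuous r → (∃ a : ℝ, ∀ x, (a : EReal) ≤ r x) →
      r x0 ≠ ⊤ →
      (∀ x, composite f r x0 ≤ composite f r x + (Δ : EReal)) →
      -- the smoothed functions are bounded below, and the approximation error is `O(η)`
      (∀ η ∈ Ioc 0 θ, ∃ a : ℝ, ∀ x, a ≤ fη η x) →
      (∀ η ∈ Ioc 0 θ, ∀ x ∈ initialLevel (composite (fη η) r) x0, Rη η x ≤ R * η) →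
      -- either a generalized smooth approximation with level-bounded smoothed objective,
      -- or generalized Nesterov smoothing with level-bounded `h_η` and lower-bounded `A_i`
      (((∀ η ∈ Ioc 0 θ,
            IsSmoothApprox f (fη η) ρbar (Rη η) (fun x y => B x y + L x y / η)) ∧
          (∀ x y, 0 ≤ B x y ∧ 0 ≤ L x y ∧ B x y = B y x ∧ L x y = L y x) ∧
          Continuous (fun p : Eucl d × Eucl d => B p.1 p.2) ∧
          Continuous (fun p : Eucl d × Eucl d => L p.1 p.2) ∧
          (∀ η ∈ Ioc 0 θ, LevelBounded (composite (fη η) r))) ∨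
        (∃ N : NesterovSmoothing d,
          (∀ x, f x = N.h (N.A x)) ∧
          (∀ η ∈ Ioc 0 θ, ∀ x, fη η x = N.hη η (N.A x) ∧ Rη η x = η * N.proxDiam) ∧
          (∀ x y, B x y = N.dualRadius * N.LA ∧ L x y = N.jacModulus x y) ∧
          N.dualRadius * N.LA ≤ ρbar ∧
          (∀ η ∈ Ioc 0 θ, ∀ v : ℝ, Bornology.IsBounded {z | N.hη η z ≤ v}) ∧
          (∀ i, BddBelow (range fun x => N.basis.repr (N.A x) i)))) →
      ∃ C' > (0 : ℝ), ∀ ε : ℝ, 0 < ε → ε ^ 2 ≤ θ →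
        -- AGLS-SIPP with `η = ε²`, `ρhat = 2 ρbar` is well defined
        (∃ xs T, IsAGLSSIPPRun (fη (ε ^ 2)) r ρbar (2 * ρbar) L0 τd τu x0 xs T) ∧
        ∀ xs T, IsAGLSSIPPRun (fη (ε ^ 2)) r ρbar (2 * ρbar) L0 τd τu x0 xs T →
          ∃ K ≥ 1, IsApproxStationary (composite f r) (c * ε) (c * ε) (xs K) ∧
            ((∑ k ∈ Finset.Icc 1 K, T k : ℕ) : ℝ) ≤ C' / ε ^ 3 ∧
            ∀ l : ℝ, (∀ x, (l : EReal) ≤ composite (fη (ε ^ 2)) r x) →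
            ∀ S0 : Set (Eucl d), S0 = initialLevel (composite (fη (ε ^ 2)) r) x0 →
            ∀ D : ℝ, D = √(8 / (2 * ρbar - ρbar) * (f x0 + (r x0).toReal - l)) →
            ∀ P : Set (Eucl d × Eucl d),
              (P = commonBallPairs S0 D ∨
                (LevelBounded (composite (fη (ε ^ 2)) r) ∧ P = tubePairs S0 D)) →
              PairBounded (fun x y => 2 * (B x y + L x y / ε ^ 2) + 2 * ρbar) P ∧
              PairBounded B P ∧ PairBounded L P ∧
              ((∑ k ∈ Finset.Icc 1 K, T k : ℕ) : ℝ) ≤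
                C * (1 / ε ^ 2 * (√(pairSup B P) + √(pairSup L P) / ε + 1)) := by
  refine ⟨(1 + 6 * ρbar) * (√((R + 2) / ρbar) + √(1 / ρbar)), by positivity,
    fun θ Δ τu L0 hθ hΔ hτu hL0 => ⟨(2 * (Δ + R * θ) + θ) * innerConst ρbar τu L0,
      mul_pos (by positivity) (innerConst_pos _ _ _), ?_⟩⟩
  intro d f r fη Rη B L x0 τd hτd hτd1 hf hconv hlsc hr hx0 hgap hlow herr hcase
  -- Weak convexity of `f` enters only through continuity; the curvature used by the method is that
  -- of the smoothed functions.
  have hfc : Continuous f := hf.continuous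
  obtain ⟨a, ha⟩ := hr
  have hbot := ne_bot_of_coe_le ha
  rcases hcase with ⟨hsm, hBL, hBc, hLc, hlev⟩ | ⟨N, hfN, hfηN, hBL, hNρ, hlev, hA⟩
  · have hbdd : ∀ ϱ : ℝ, ∃ b e : ℝ, ∀ x y : Eucl d, ‖x‖ ≤ ϱ → ‖y‖ ≤ ϱ → B x y ≤ b ∧ L x y ≤ e := by
      intro ϱ
      obtain ⟨b, hb⟩ := exists_bound_on_closedBall hBc ϱ
      obtain ⟨e, he⟩ := exists_bound_on_closedBall hLc ϱ
      exact ⟨b, e, fun x y hx hy => ⟨hb x y hx hy, he x y hx hy⟩⟩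
    exact complexity_of_isSmoothApprox hρbar hR hθ hΔ hτu hL0 hτd hτd1 hfc hconv hlsc ⟨a, ha⟩ hx0
      hgap hlow herr hsm (fun x y => (hBL x y).1) (fun x y => (hBL x y).2.1)
      (exists_ball_bound_of_levelBounded hθ hR hbot hx0 herr hsm (hlev θ ⟨hθ, le_rfl⟩) hbdd) hbdd
  · have hsm : ∀ η ∈ Ioc 0 θ,
        IsSmoothApprox f (fη η) ρbar (Rη η) (fun x y => B x y + L x y / η) := by
      intro η hη
      have h := NesterovSmoothing.isSmoothApprox (N := N) hη.1 hNρ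
      have e1 : f = fun x => N.h (N.A x) := funext hfN
      have e2 : fη η = fun x => N.hη η (N.A x) := funext fun x => (hfηN η hη x).1
      have e3 : Rη η = fun _ => η * N.proxDiam := funext fun x => (hfηN η hη x).2
      have e4 : (fun x y => B x y + L x y / η)
          = fun x y => N.dualRadius * N.LA + N.jacModulus x y / η := by
        funext x y
        rw [(hBL x y).1, (hBL x y).2]
      rw [e1, e2, e3, e4]
      exact h
    exact complexity_of_isSmoothApprox hρbar hR hθ hΔ hτu hL0 hτd hτd1 hfc hconv hlsc ⟨a, ha⟩ hx0
      hgap hlow herr hsm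
      (fun x y => (hBL x y).1 ▸ mul_nonneg N.dualRadius_nonneg N.LA_nonneg)
      (fun x y => (hBL x y).2 ▸ N.jacModulus_nonneg x y)
      (N.exists_ball_bound hθ hR ha hx0 hfN herr hsm hBL (hlev θ ⟨hθ, le_rfl⟩) hA)
      (N.exists_bound hBL)
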